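/- Let $(M,g)$ be a smooth, connected, Hausdorff pseudo-Riemannian manifold (metric of any signature) of dimension $n\ge 5$, with Levi-Civita connection $\nabla$. Let $R_{jkl}{}^m$ be the Riemann tensor, with the sign convention $[\nabla_j,\nabla_k]a_l=R_{jkl}{}^m a_m$ for covector fields $a$, let $R_{kl}=-R_{mkl}{}^m$ be the Ricci tensor, $R=g^{ij}R_{ij}$ the scalar curvature, and $$C_{jkl}{}^m=R_{jkl}{}^m+\frac{1}{n-2}\left(\delta_j{}^mR_{kl}-\delta_k{}^mR_{jl}+R_j{}^mg_{kl}-R_k{}^mg_{jl}\right)-R\,\frac{\delta_j{}^mg_{kl}-\delta_k{}^mg_{jl}}{(n-1)(n-2)}$$ the Weyl tensor. A tensor $b_{ij}$ is called Weyl compatible if $$b_{im}C_{jkl}{}^m+b_{jm}C_{kil}{}^m+b_{km}C_{ijl}{}^m=0,$$ and Riemann compatible if the same identity holds with $R_{jkl}{}^m$ in place of $C_{jkl}{}^m$. Suppose that $(M,g)$ is conformally recurrent: there is a smooth covector field $\alpha$, not identically zero (the recurrence vector), with $$\nabla_iC_{jklm}=\alpha_iC_{jklm}.$$ Then the tensors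 $$\alpha_i\alpha_j,\qquad \nabla_i\alpha_j+\nabla_j\alpha_i+R_{ij},\qquad \nabla_i\alpha_m-\nabla_m\alpha_i+\frac{n-4}{n-2}\,R_{im}$$ are Weyl compatible. If moreover $\alpha$ is closed, i.e. $\nabla_i\alpha_j-\nabla_j\alpha_i=0$, then $\nabla_i\alpha_j$ and $R_{ij}$ are Weyl compatible, and $R_{ij}$ is also Riemann compatible: $$R_{im}R_{jkl}{}^m+R_{jm}R_{kil}{}^m+R_{km}R_{ijl}{}^m=0.$$ -/

import Mathlib

open scoped Manifold ContDiff

noncomputable section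

namespace ConfRec

/-! ### Tensor calculus in coordinates

Throughout, `g z` is the matrix of components `g_{ij}` of a metric at the point `z` of a coordinate
domain in `ℝⁿ`, and the summation convention is written out. Indices are listed in the order in
which they are written in index notation; for mixed tensors, the last index is the upper one. -/

/-- The coordinate partial derivative `∂_i f` at `y`. -/
def pd {n : ℕ} (i : Fin n) (f : EuclideanSpace ℝ (Fin n) → ℝ) (y : EuclideanSpace ℝ (Fin n)) : ℝ :=
  fderiv ℝ f y (EuclideanSpace.single i 1)

/-- Christoffel symbols `Γ_{ij}^k` of the Levi-Civita connection of `g`. -/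
def christoffel {n : ℕ} (g : EuclideanSpace ℝ (Fin n) → Matrix (Fin n) (Fin n) ℝ)
    (i j k : Fin n) (y : EuclideanSpace ℝ (Fin n)) : ℝ :=
  (1 / 2) * ∑ l, (g y)⁻¹ k l *
    (pd i (fun z => g z j l) y + pd j (fun z => g z i l) y - pd l (fun z => g z i j) y)

/-- Components `∇_i a_j` of the covariant derivative of a covector field `a`. -/
def covDeriv1 {n : ℕ} (g : EuclideanSpace ℝ (Fin n) → Matrix (Fin n) (Fin n) ℝ)
    (a : EuclideanSpace ℝ (Fin n) → Fin n → ℝ) (y : EuclideanSpace ℝ (Fin n)) (i j : Fin n) : ℝ :=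
  pd i (fun z => a z j) y - ∑ p, christoffel g i j p y * a y p

/-- Components `∇_i T_{jklm}` of the covariant derivative of a covariant 4-tensor field `T`. -/
def covDeriv4 {n : ℕ} (g : EuclideanSpace ℝ (Fin n) → Matrix (Fin n) (Fin n) ℝ)
    (T : EuclideanSpace ℝ (Fin n) → Fin n → Fin n → Fin n → Fin n → ℝ)
    (y : EuclideanSpace ℝ (Fin n)) (i j k l m : Fin n) : ℝ :=
  pd i (fun z => T z j k l m) y
    - ∑ p, (christoffel g i j p y * T y p k l m + christoffel g i k p y * T y j p l m
      + christoffel g i l p y * T y j k p m + christoffel g i m p y * T y j k l p)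

/-- Components `R_{jkl}^m` of the Riemann tensor, with the sign convention
`(∇_j ∇_k - ∇_k ∇_j) a_l = R_{jkl}^m a_m` for covector fields `a`. -/
def riemann {n : ℕ} (g : EuclideanSpace ℝ (Fin n) → Matrix (Fin n) (Fin n) ℝ)
    (y : EuclideanSpace ℝ (Fin n)) (j k l m : Fin n) : ℝ :=
  pd k (christoffel g j l m) y - pd j (christoffel g k l m) y
    + ∑ p, (christoffel g j l p y * christoffel g k p m y
      - christoffel g k l p y * christoffel g j p m y)

/-- Components `R_{kl} = - R_{mkl}^m` of the Ricci tensor. -/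
def ricci {n : ℕ} (g : EuclideanSpace ℝ (Fin n) → Matrix (Fin n) (Fin n) ℝ)
    (y : EuclideanSpace ℝ (Fin n)) (k l : Fin n) : ℝ :=
  -∑ m, riemann g y m k l m

/-- The scalar curvature `R = g^{ij} R_{ij}`. -/
def scalarCurv {n : ℕ} (g : EuclideanSpace ℝ (Fin n) → Matrix (Fin n) (Fin n) ℝ)
    (y : EuclideanSpace ℝ (Fin n)) : ℝ :=
  ∑ i, ∑ j, (g y)⁻¹ i j * ricci g y i j

/-- Components `R_j^m = R_{jp} g^{pm}` of the Ricci tensor with its second index raised. -/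
def ricciUp {n : ℕ} (g : EuclideanSpace ℝ (Fin n) → Matrix (Fin n) (Fin n) ℝ)
    (y : EuclideanSpace ℝ (Fin n)) (j m : Fin n) : ℝ :=
  ∑ p, ricci g y j p * (g y)⁻¹ p m

/-- Components `C_{jkl}^m` of the Weyl (conformal curvature) tensor; `if j = m then 1 else 0` is
the Kronecker delta. -/
def weyl {n : ℕ} (g : EuclideanSpace ℝ (Fin n) → Matrix (Fin n) (Fin n) ℝ)
    (y : EuclideanSpace ℝ (Fin n)) (j k l m : Fin n) : ℝ :=
  riemann g y j k l m
    + 1 / ((n : ℝ) - 2) * ((if j = m then 1 else 0) * ricci g y k l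
      - (if k = m then 1 else 0) * ricci g y j l
      + ricciUp g y j m * g y k l - ricciUp g y k m * g y j l)
    - scalarCurv g y * ((if j = m then 1 else 0) * g y k l - (if k = m then 1 else 0) * g y j l)
      / (((n : ℝ) - 1) * ((n : ℝ) - 2))

/-- Components `C_{jklm} = C_{jkl}^p g_{pm}` of the covariant Weyl tensor. -/
def weylDown {n : ℕ} (g : EuclideanSpace ℝ (Fin n) → Matrix (Fin n) (Fin n) ℝ)
    (y : EuclideanSpace ℝ (Fin n)) (j k l m : Fin n) : ℝ :=
  ∑ p, weyl g y j k l p * g y p m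

/-- A tensor `b_{ij}` at a point is compatible with the curvature-like tensor `K_{jkl}^m` if
`b_{im} K_{jkl}^m + b_{jm} K_{kil}^m + b_{km} K_{ijl}^m = 0`. -/
def IsCompatible {n : ℕ} (K : Fin n → Fin n → Fin n → Fin n → ℝ) (b : Fin n → Fin n → ℝ) : Prop :=
  ∀ i j k l, ∑ m, (b i m * K j k l m + b j m * K k i l m + b k m * K i j l m) = 0

/-! ### Pseudo-Riemannian manifolds -/

/-- A smooth pseudo-Riemannian metric (of any signature) on an `n`-dimensional manifold. -/
structure PseudoRiemannianMetric (n : ℕ) (M : Type*) [TopologicalSpace M]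
    [ChartedSpace (EuclideanSpace ℝ (Fin n)) M] [IsManifold (𝓡 n) ∞ M] where
  /-- The metric at each point, as a bilinear form on the tangent space. -/
  val : ∀ x : M, TangentSpace (𝓡 n) x →L[ℝ] TangentSpace (𝓡 n) x →L[ℝ] ℝ
  symm : ∀ (x : M) (v w : TangentSpace (𝓡 n) x), val x v w = val x w v
  nondegenerate : ∀ (x : M) (v : TangentSpace (𝓡 n) x), (∀ w, val x v w = 0) → v = 0
  contMDiff : ContMDiff (𝓡 n) ((𝓡 n).prod 𝓘(ℝ, EuclideanSpace ℝ (Fin n) →L[ℝ]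
      EuclideanSpace ℝ (Fin n) →L[ℝ] ℝ)) ∞
    (fun x => Bundle.TotalSpace.mk' (EuclideanSpace ℝ (Fin n) →L[ℝ]
      EuclideanSpace ℝ (Fin n) →L[ℝ] ℝ)
      (E := fun x : M => TangentSpace (𝓡 n) x →L[ℝ] TangentSpace (𝓡 n) x →L[ℝ] ℝ) x (val x))

/-- A smooth covector field (1-form) on an `n`-dimensional manifold. -/
structure CovectorField (n : ℕ) (M : Type*) [TopologicalSpace M]
    [ChartedSpace (EuclideanSpace ℝ (Fin n)) M] [IsManifold (𝓡 n) ∞ M] where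
  /-- The value at each point, as a linear form on the tangent space. -/
  val : ∀ x : M, TangentSpace (𝓡 n) x →L[ℝ] ℝ
  contMDiff : ContMDiff (𝓡 n) ((𝓡 n).prod 𝓘(ℝ, EuclideanSpace ℝ (Fin n) →L[ℝ] ℝ)) ∞
    (fun x => Bundle.TotalSpace.mk' (EuclideanSpace ℝ (Fin n) →L[ℝ] ℝ)
      (E := fun x : M => TangentSpace (𝓡 n) x →L[ℝ] ℝ) x (val x))

section

variable {n : ℕ} {M : Type*} [TopologicalSpace M] [ChartedSpace (EuclideanSpace ℝ (Fin n)) M]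

attribute [local instance 2000] chartedSpaceSelf

/-- The coordinate vector `∂/∂xⁱ` of the chart `e`, at the point of `M` with coordinates `y`. -/
def coordVec (e : OpenPartialHomeomorph M (EuclideanSpace ℝ (Fin n))) (i : Fin n)
    (y : EuclideanSpace ℝ (Fin n)) : TangentSpace (𝓡 n) (e.symm y) :=
  mfderiv (𝓡 n) (𝓡 n) e.symm y (EuclideanSpace.single i (1 : ℝ) : EuclideanSpace ℝ (Fin n))

variable [IsManifold (𝓡 n) ∞ M]

/-- The matrix of components `g_{ij}` of the metric in the chart `e`, as a function of the
coordinates. -/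
def PseudoRiemannianMetric.comp (g : PseudoRiemannianMetric n M)
    (e : OpenPartialHomeomorph M (EuclideanSpace ℝ (Fin n))) (y : EuclideanSpace ℝ (Fin n)) :
    Matrix (Fin n) (Fin n) ℝ :=
  Matrix.of fun i j => g.val (e.symm y) (coordVec e i y) (coordVec e j y)

/-- The components `a_i` of a covector field in the chart `e`, as functions of the coordinates. -/
def CovectorField.comp (a : CovectorField n M)
    (e : OpenPartialHomeomorph M (EuclideanSpace ℝ (Fin n))) (y : EuclideanSpace ℝ (Fin n))
    (i : Fin n) : ℝ :=
  a.val (e.symm y) (coordVec e i y)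

/-- `(M, g)` is conformally recurrent with recurrence vector `a`: the covector field `a` is not
the zero field, and `∇_i C_{jklm} = a_i C_{jklm}` in all local coordinates. -/
def IsConformallyRecurrent (g : PseudoRiemannianMetric n M) (a : CovectorField n M) : Prop :=
  (∃ x, a.val x ≠ 0) ∧
  ∀ e ∈ IsManifold.maximalAtlas (𝓡 n) ∞ M, ∀ y ∈ e.target, ∀ i j k l m,
    covDeriv4 (g.comp e) (weylDown (g.comp e)) y i j k l m
      = a.comp e y i * weylDown (g.comp e) y j k l m

/-- The covector field `a` is closed: `∇_i a_j - ∇_j a_i = 0` in all local coordinates. -/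
def CovectorField.IsClosed (g : PseudoRiemannianMetric n M) (a : CovectorField n M) : Prop :=
  ∀ e ∈ IsManifold.maximalAtlas (𝓡 n) ∞ M, ∀ y ∈ e.target, ∀ i j,
    covDeriv1 (g.comp e) (a.comp e) y i j - covDeriv1 (g.comp e) (a.comp e) y j i = 0

/-- The covariant 2-tensor field with components `b e y i j` in the chart `e` at the point with
coordinates `y` is Weyl compatible. -/
def IsWeylCompatible (g : PseudoRiemannianMetric n M)
    (b : OpenPartialHomeomorph M (EuclideanSpace ℝ (Fin n)) → EuclideanSpace ℝ (Fin n) →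
      Fin n → Fin n → ℝ) : Prop :=
  ∀ e ∈ IsManifold.maximalAtlas (𝓡 n) ∞ M, ∀ y ∈ e.target,
    IsCompatible (weyl (g.comp e) y) (b e y)

/-- The covariant 2-tensor field with components `b e y i j` in the chart `e` at the point with
coordinates `y` is Riemann compatible. -/
def IsRiemannCompatible (g : PseudoRiemannianMetric n M)
    (b : OpenPartialHomeomorph M (EuclideanSpace ℝ (Fin n)) → EuclideanSpace ℝ (Fin n) →
      Fin n → Fin n → ℝ) : Prop :=
  ∀ e ∈ IsManifold.maximalAtlas (𝓡 n) ∞ M, ∀ y ∈ e.target,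
    IsCompatible (riemann (g.comp e) y) (b e y)

end

end ConfRec

end

/-! Let `L` be the Schouten tensor, so that with all indices down `C` is the Riemann tensor plus the
product `metricProd g L`, and `Ric = (n-2) L + (tr L) g`. Call `b` compatible if its cyclic sum with
`C` (`compatSum`) vanishes. Three identities carry the proof.

(1) The second Bianchi identity turns the cyclic sum of `α_i C_{jklm}` into metric terms in the
Cotton tensor `X_{jkl} = ∇_k L_{jl} - ∇_j L_{kl}`. Its trace gives `(n-3) X_{jkl} = α^q C_{jklq}`
(`trace_recurrent_bianchi`). Contracting the untraced identity with `α^m` equates the cyclic sums of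
`α_i α^q C_{jklq}` and `α_i X_{jkl}`; the trace formula says that the first is `n-3` times the
second, so both vanish because `n ≠ 4`, and `α_i α_j` is compatible (`recurrent_sq_compatible`).

(2) By the Ricci identity the cyclic sum of `∇_i X_{jkl}` is minus the compatibility sum of `L`. By
(1), `n-3` times the same cyclic sum is the compatibility sum of `∇α`. Hence `∇_i α_j + (n-3)
L_{ij}` is compatible (`IsRecurrent.compatSum_eq_zero`).

(3) The commutator `[∇_i, ∇_j] C` equals `(∇_i α_j - ∇_j α_i) C`, and also the curvature acting on
the four indices of `C`. After one contraction and a cyclic sum the terms quadratic in `C` cancel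
(`dcontr_curvature_cyclic`); what remains says that `∇_i α_j - ∇_j α_i + (n-4) L_{ij}` is compatible
(`commutator_compatible`).

The metric is compatible by the first Bianchi identity, so multiples of `L` can be traded for
multiples of `Ric`; twice (2) minus (3), and (3) itself, are the claims. If `α` is closed, (3)
reduces to `L`, and (2) then gives `∇α`. Riemann compatibility follows because `L` is compatible
with `metricProd g L`.

All of this takes place in an `ℝ`-algebra with commuting derivations and matrices of Christoffel
symbols. It is applied to the ring of smooth functions on a chart domain (`smoothRing`) and
evaluated at a point. -/

noncomputable section

namespace ConfRec

/-! ### Curvature symmetries, contractions, and the Cotton tensor of a recurrent Weyl tensor. -/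

section Algebra

variable {A : Type*} [CommRing A] {ι : Type*}

theorem eq_zero_of_two_mul_eq_zero [Algebra ℝ A] {x : A} (h : 2 * x = 0) : x = 0 := by
  have h2 : algebraMap ℝ A (1 / 2) * (2 * x) = x := by
    have : (2 : A) = algebraMap ℝ A 2 := (map_ofNat (algebraMap ℝ A) 2).symm
    rw [this, ← mul_assoc, ← map_mul]
    norm_num
  rw [← h2, h, mul_zero]

/-- A ring of smooth functions has zero divisors, so dimension factors such as `n - 4` are cancelled
by inverting them as real scalars. -/
theorem eq_zero_of_natCast_sub_mul_eq_zero [Algebra ℝ A] {n k : ℕ} (hk : n ≠ k) {x : A}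
    (h : ((n : A) - k) * x = 0) : x = 0 := by
  have hr : (n : ℝ) - k ≠ 0 := sub_ne_zero.2 (by exact_mod_cast hk)
  have h2 : algebraMap ℝ A (((n : ℝ) - k)⁻¹) * (((n : A) - k) * x) = x := by
    have : (n : A) - k = algebraMap ℝ A ((n : ℝ) - k) := by simp
    rw [this, ← mul_assoc, ← map_mul, inv_mul_cancel₀ hr, map_one, one_mul]
  rw [← h2, h, mul_zero]

/-- The algebraic symmetries of a covariant curvature tensor. -/
structure IsCurvatureLike (C : ι → ι → ι → ι → A) : Prop where
  antisymm_left : ∀ j k l m, C j k l m = -C k j l m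
  antisymm_right : ∀ j k l m, C j k l m = -C j k m l
  bianchi : ∀ j k l m, C j k l m + C k l j m + C l j k m = 0

namespace IsCurvatureLike

variable [Algebra ℝ A] {C : ι → ι → ι → ι → A}

theorem pair_symm (hC : IsCurvatureLike C) (j k l m : ι) : C j k l m = C l m j k := by
  rw [← sub_eq_zero]
  apply eq_zero_of_two_mul_eq_zero
  linear_combination
    hC.bianchi j k l m + hC.bianchi k l m j - hC.bianchi l m j k - hC.bianchi m j k l
    - hC.antisymm_left l j k m - hC.antisymm_right k l m j - hC.antisymm_right l m k j
    - hC.antisymm_left m k l j + hC.antisymm_right k m l j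
    + hC.antisymm_left m j l k - hC.antisymm_right j m l k + hC.antisymm_right j l m k
    + hC.antisymm_left m j k l + hC.antisymm_right j k m l

/-- The first Bianchi identity in the last three indices. -/
theorem bianchi_right (hC : IsCurvatureLike C) (j k l m : ι) :
    C j k l m + C j l m k + C j m k l = 0 := by
  linear_combination hC.pair_symm j k l m + hC.pair_symm j l m k + hC.pair_symm j m k l
    + hC.antisymm_right l m j k + hC.antisymm_right m k j l + hC.antisymm_right k l j m
    - hC.bianchi l m k j

/-- The Bianchi identity as used on quadratic terms: antisymmetrizing in two non-adjacent slots
moves them into an antisymmetric pair. -/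
theorem antisymmetrize (hC : IsCurvatureLike C) (i j k q : ι) :
    C i j k q - C k j i q = C i k j q := by
  linear_combination hC.bianchi_right i j k q - hC.pair_symm k j i q - hC.antisymm_right i q k j
    - hC.antisymm_right i k q j

theorem antisymmetrize' (hC : IsCurvatureLike C) (i j k q : ι) :
    C i j k q - C i q k j = C i k j q := by
  linear_combination hC.bianchi_right i j k q - hC.antisymm_right i q k j
    - hC.antisymm_right i k q j

end IsCurvatureLike

variable [Fintype ι]

/-- The contraction of a bilinear form `T` with the (inverse) metric `h`. -/
def contr (h : Matrix ι ι A) (T : ι → ι → A) : A := ∑ i, ∑ m, h i m * T i m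

/-- Raising the index of a covector `u` with the (inverse) metric `h`. -/
def raise (h : Matrix ι ι A) (u : ι → A) (p : ι) : A := ∑ q, h p q * u q

/-- The full contraction of two bilinear forms with the (inverse) metric `h`. -/
def dcontr (h : Matrix ι ι A) (P Q : ι → ι → A) : A :=
  ∑ j, ∑ n, ∑ q, ∑ p, h j n * h q p * (P j q * Q n p)

section contr

variable (h : Matrix ι ι A)

theorem contr_add (S T : ι → ι → A) :
    contr h (fun i m => S i m + T i m) = contr h S + contr h T := by
  simp only [contr, mul_add, Finset.sum_add_distrib]

theorem contr_sub (S T : ι → ι → A) :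
    contr h (fun i m => S i m - T i m) = contr h S - contr h T := by
  simp only [contr, mul_sub, Finset.sum_sub_distrib]

theorem contr_neg (T : ι → ι → A) : contr h (fun i m => -T i m) = -contr h T := by
  simp only [contr, mul_neg, Finset.sum_neg_distrib]

theorem contr_mul_left (c : A) (T : ι → ι → A) :
    contr h (fun i m => c * T i m) = c * contr h T := by
  simp only [contr, Finset.mul_sum]
  exact Finset.sum_congr rfl fun i _ => Finset.sum_congr rfl fun m _ => by ring

theorem contr_sum {κ : Type*} (s : Finset κ) (T : κ → ι → ι → A) :
    contr h (fun i m => ∑ p ∈ s, T p i m) = ∑ p ∈ s, contr h (T p) := by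
  simp only [contr, Finset.mul_sum]
  rw [Finset.sum_comm (s := s)]
  exact Finset.sum_congr rfl fun i _ => Finset.sum_comm

theorem contr_swap (hh : ∀ i j, h i j = h j i) (T : ι → ι → A) :
    contr h (fun i m => T m i) = contr h T := by
  unfold contr
  rw [Finset.sum_comm]
  exact Finset.sum_congr rfl fun i _ => Finset.sum_congr rfl fun m _ => by rw [hh]

theorem contr_mul_apply (hh : ∀ i j, h i j = h j i) (a T : ι → A) :
    contr h (fun i m => a i * T m) = ∑ m, raise h a m * T m := by
  simp only [contr, raise, Finset.sum_mul]
  rw [Finset.sum_comm]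
  exact Finset.sum_congr rfl fun i _ => Finset.sum_congr rfl fun m _ => by rw [hh]; ring

end contr

variable [DecidableEq ι] {g h : Matrix ι ι A}

theorem sum_inv_mul (hgh : h * g = 1) (i j : ι) :
    ∑ k, h i k * g k j = if i = j then 1 else 0 := by
  have := congrFun (congrFun hgh i) j
  rwa [Matrix.mul_apply, Matrix.one_apply] at this

theorem contr_metric (hg : ∀ i j, g i j = g j i) (hgh : h * g = 1) (c : A) :
    contr h (fun i m => g i m * c) = (Fintype.card ι : A) * c := by
  have : ∀ i, ∑ m, h i m * (g i m * c) = c := by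
    intro i
    have := sum_inv_mul hgh i i
    simp only [if_true] at this
    calc _ = (∑ k, h i k * g k i) * c := by
          rw [Finset.sum_mul]
          exact Finset.sum_congr rfl fun m _ => by rw [hg i m]; ring
      _ = _ := by rw [this, one_mul]
  unfold contr
  simp [this]

theorem contr_metric_mul (hg : ∀ i j, g i j = g j i) (hgh : h * g = 1) (j : ι) (T : ι → A) :
    contr h (fun i m => g j m * T i) = T j := by
  have : ∀ i, ∑ m, h i m * (g j m * T i) = if i = j then T i else 0 := by
    intro i
    have := sum_inv_mul hgh i j
    calc _ = (∑ k, h i k * g k j) * T i := by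
          rw [Finset.sum_mul]
          exact Finset.sum_congr rfl fun m _ => by rw [hg j m]; ring
      _ = _ := by rw [this]; split_ifs <;> simp
  unfold contr
  simp [this]

theorem contr_metric_mul' (hg : ∀ i j, g i j = g j i) (hh : ∀ i j, h i j = h j i)
    (hgh : h * g = 1) (j : ι) (T : ι → A) :
    contr h (fun i m => g i j * T m) = T j := by
  rw [← contr_swap h hh, ← contr_metric_mul hg hgh j T]
  simp only [hg j]

theorem sum_raise_mul_metric (hgh : g * h = 1) (a : ι → A) (i : ι) :
    ∑ m, raise h a m * g i m = a i := by
  simp only [raise, Finset.sum_mul]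
  rw [Finset.sum_comm]
  have : ∀ q, ∑ m, h m q * a q * g i m = if i = q then a q else 0 := by
    intro q
    calc _ = (∑ m, g i m * h m q) * a q := by
          rw [Finset.sum_mul]
          exact Finset.sum_congr rfl fun m _ => by ring
      _ = _ := by rw [sum_inv_mul hgh]; split_ifs <;> simp
  simp [this]

theorem sum_raise_metric_mul (hg : ∀ i j, g i j = g j i) (hgh : h * g = 1) (i : ι) (T : ι → A) :
    ∑ m, raise h (g i) m * T m = T i := by
  have : ∀ m, raise h (g i) m = if m = i then 1 else 0 := by
    intro m
    rw [← sum_inv_mul hgh]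
    exact Finset.sum_congr rfl fun q _ => by rw [hg]
  simp [this]

/-- The trace of the second Bianchi identity of a recurrent Weyl tensor determines the Cotton
tensor `X`. -/
theorem trace_recurrent_bianchi [Algebra ℝ A] (hg : ∀ i j, g i j = g j i)
    (hh : ∀ i j, h i j = h j i) (hgh : h * g = 1) (hn : 5 ≤ Fintype.card ι)
    {C : ι → ι → ι → ι → A} (hC : IsCurvatureLike C)
    (htr : ∀ k l, contr h (fun j m => C j k l m) = 0) {a : ι → A} {X : ι → ι → ι → A}
    (hX : ∀ j k l, X j k l = -X k j l)
    (hE : ∀ i j k l m, a i * C j k l m + a j * C k i l m + a k * C i j l m =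
      g i m * X j k l + g j m * X k i l + g k m * X i j l
        - (g i l * X j k m + g j l * X k i m + g k l * X i j m)) (j k l : ι) :
    ((Fintype.card ι : A) - 3) * X j k l = ∑ q, raise h a q * C j k l q := by
  have htr2 : ∀ k l, contr h (fun i m => C k i l m) = 0 := by
    intro k l
    simp only [fun i m => hC.antisymm_left k i l m, contr_neg, htr, neg_zero]
  have htr3 : ∀ k m, contr h (fun j l => C j k l m) = 0 := by
    intro k m
    simp only [fun j l => hC.antisymm_right j k l m, contr_neg, htr, neg_zero]
  -- The trace of `hE` over `i`, `m`. The coefficient `n - 3` collects `n` from `g i m`, `-2` from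
  -- `g j m` and `g k m`, and `-1` from `g i l`.
  have h1 : ∀ j k l, ∑ q, raise h a q * C j k l q = ((Fintype.card ι : A) - 3) * X j k l
      - g j l * contr h (X k) + g k l * contr h (X j) := by
    intro j k l
    have := congrArg (contr h) (funext fun i => funext fun m => hE i j k l m)
    simp only [contr_add, contr_sub, contr_mul_left, htr, htr2, contr_metric hg hgh,
      contr_metric_mul hg hgh, contr_metric_mul' hg hh hgh, mul_zero, add_zero,
      contr_mul_apply h hh] at this
    rw [this, show contr h (fun i m => X i j m) = -contr h (X j) by
      simp only [fun i m => hX i j m, contr_neg], hX k j l]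
    ring
  -- Tracing `h1` over `j`, `l` kills the left side and leaves `2 (n - 2)` times the trace of `X k`.
  have h2 : ∀ k, contr h (X k) = 0 := by
    intro k
    have := congrArg (contr h) (funext fun j => funext fun l => h1 j k l)
    simp only [contr_add, contr_sub, contr_mul_left, contr_sum, htr3, mul_zero,
      Finset.sum_const_zero, contr_metric hg hgh, contr_metric_mul hg hgh] at this
    rw [show contr h (fun j l => X j k l) = -contr h (X k) by
      simp only [fun i m => hX i k m, contr_neg]] at this
    apply eq_zero_of_two_mul_eq_zero
    apply eq_zero_of_natCast_sub_mul_eq_zero (n := Fintype.card ι) (k := 2) (by omega)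
    push_cast
    linear_combination this
  rw [h1, h2, h2]
  ring

/-- The square of the recurrence covector is compatible with the Weyl tensor. -/
theorem recurrent_sq_compatible [Algebra ℝ A] (hgh : g * h = 1) (hn : 5 ≤ Fintype.card ι)
    {C : ι → ι → ι → ι → A} (hC : IsCurvatureLike C) {a : ι → A} {X : ι → ι → ι → A}
    (hE : ∀ i j k l m, a i * C j k l m + a j * C k i l m + a k * C i j l m =
      g i m * X j k l + g j m * X k i l + g k m * X i j l
        - (g i l * X j k m + g j l * X k i m + g k l * X i j m))
    (hXC : ∀ j k l, ((Fintype.card ι : A) - 3) * X j k l = ∑ q, raise h a q * C j k l q)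
    (i j k l : ι) :
    a i * (∑ q, raise h a q * C j k l q) + a j * (∑ q, raise h a q * C k i l q)
      + a k * (∑ q, raise h a q * C i j l q) = 0 := by
  -- Up to the factor `n - 3` this is `a^m a^q C_{jkmq}`, a symmetric product against an
  -- antisymmetric pair.
  have h0 : ∀ j k, ∑ m, raise h a m * X j k m = 0 := by
    intro j k
    apply eq_zero_of_natCast_sub_mul_eq_zero (n := Fintype.card ι) (k := 3) (by omega)
    apply eq_zero_of_two_mul_eq_zero
    have : ((Fintype.card ι : A) - (3 : ℕ)) * ∑ m, raise h a m * X j k m =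
        ∑ m, ∑ q, raise h a m * (raise h a q * C j k m q) := by
      rw [Finset.mul_sum]
      refine Finset.sum_congr rfl fun m _ => ?_
      rw [← Finset.mul_sum, ← hXC]
      push_cast
      ring
    rw [this, two_mul]
    conv_lhs => arg 2; rw [Finset.sum_comm]
    rw [← Finset.sum_add_distrib]
    refine Finset.sum_eq_zero fun m _ => ?_
    rw [← Finset.sum_add_distrib]
    refine Finset.sum_eq_zero fun q _ => ?_
    rw [hC.antisymm_right j k q m]
    ring
  -- Let `S` be the goal's sum and `T` the cyclic sum of `a_i X_{jkl}`. Below, `h1` gives `S = T`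
  -- and `h4` gives `(n - 3) T = S`, so `(n - 4) S = 0`.
  apply eq_zero_of_natCast_sub_mul_eq_zero (n := Fintype.card ι) (k := 4) (by omega)
  have h1 : a i * (∑ q, raise h a q * C j k l q) + a j * (∑ q, raise h a q * C k i l q)
      + a k * (∑ q, raise h a q * C i j l q) =
      a i * X j k l + a j * X k i l + a k * X i j l := by
    have h2 : ∑ m, raise h a m * (a i * C j k l m + a j * C k i l m + a k * C i j l m) =
        ∑ m, (X j k l * (raise h a m * g i m) + X k i l * (raise h a m * g j m)
          + X i j l * (raise h a m * g k m)
          - (g i l * (raise h a m * X j k m) + g j l * (raise h a m * X k i m)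
            + g k l * (raise h a m * X i j m))) := by
      refine Finset.sum_congr rfl fun m _ => ?_
      rw [hE]
      ring
    simp only [Finset.sum_add_distrib, Finset.sum_sub_distrib, ← Finset.mul_sum,
      sum_raise_mul_metric hgh, h0] at h2
    have h3 : ∑ m, raise h a m * (a i * C j k l m + a j * C k i l m + a k * C i j l m) =
        a i * (∑ q, raise h a q * C j k l q) + a j * (∑ q, raise h a q * C k i l q)
      + a k * (∑ q, raise h a q * C i j l q) := by
      simp only [Finset.mul_sum, ← Finset.sum_add_distrib]
      exact Finset.sum_congr rfl fun m _ => by ring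
    rw [← h3, h2]
    ring
  have h4 : ((Fintype.card ι : A) - 3) * (a i * X j k l + a j * X k i l + a k * X i j l) =
      a i * (∑ q, raise h a q * C j k l q) + a j * (∑ q, raise h a q * C k i l q)
      + a k * (∑ q, raise h a q * C i j l q) := by
    rw [← hXC, ← hXC, ← hXC]
    ring
  rw [← h1] at h4
  push_cast
  linear_combination h4

end Algebra

/-! ### Double contractions of bilinear forms. -/

section DoubleContraction

variable {A : Type*} [CommRing A] {ι : Type*} [Fintype ι] (h : Matrix ι ι A)

theorem dcontr_sub_left (P P' Q : ι → ι → A) :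
    dcontr h (fun j q => P j q - P' j q) Q = dcontr h P Q - dcontr h P' Q := by
  simp only [dcontr, sub_mul, mul_sub, Finset.sum_sub_distrib]

theorem dcontr_add_left (P P' Q : ι → ι → A) :
    dcontr h (fun j q => P j q + P' j q) Q = dcontr h P Q + dcontr h P' Q := by
  simp only [dcontr, add_mul, mul_add, Finset.sum_add_distrib]

theorem dcontr_mul_left (c : A) (P Q : ι → ι → A) :
    dcontr h (fun j q => c * P j q) Q = c * dcontr h P Q := by
  simp only [dcontr, Finset.mul_sum]
  exact Finset.sum_congr rfl fun j _ => Finset.sum_congr rfl fun n _ =>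
    Finset.sum_congr rfl fun q _ => Finset.sum_congr rfl fun p _ => by ring

theorem dcontr_comm (hh : ∀ i j, h i j = h j i) (P Q : ι → ι → A) :
    dcontr h P Q = dcontr h Q P := by
  unfold dcontr
  rw [Finset.sum_comm]
  refine Finset.sum_congr rfl fun j _ => Finset.sum_congr rfl fun n _ => ?_
  rw [Finset.sum_comm]
  refine Finset.sum_congr rfl fun q _ => Finset.sum_congr rfl fun p _ => ?_
  rw [hh n j, hh p q]
  ring

theorem dcontr_neg_left (P Q : ι → ι → A) :
    dcontr h (fun j q => -P j q) Q = -dcontr h P Q := by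
  simp only [dcontr, neg_mul, mul_neg, Finset.sum_neg_distrib]

theorem dcontr_sub_right (P Q Q' : ι → ι → A) :
    dcontr h P (fun j q => Q j q - Q' j q) = dcontr h P Q - dcontr h P Q' := by
  simp only [dcontr, mul_sub, Finset.sum_sub_distrib]

theorem dcontr_neg_right (P Q : ι → ι → A) :
    dcontr h P (fun j q => -Q j q) = -dcontr h P Q := by
  simp only [dcontr, mul_neg, Finset.sum_neg_distrib]

theorem dcontr_swap (P Q : ι → ι → A) :
    dcontr h (fun j q => P q j) (fun n p => Q p n) = dcontr h P Q := by
  unfold dcontr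
  calc _ = ∑ j, ∑ q, ∑ n, ∑ p, h j n * h q p * (P q j * Q p n) :=
        Finset.sum_congr rfl fun j _ => Finset.sum_comm
    _ = ∑ q, ∑ j, ∑ n, ∑ p, h j n * h q p * (P q j * Q p n) := Finset.sum_comm
    _ = ∑ q, ∑ j, ∑ p, ∑ n, h j n * h q p * (P q j * Q p n) :=
        Finset.sum_congr rfl fun q _ => Finset.sum_congr rfl fun j _ => Finset.sum_comm
    _ = ∑ q, ∑ p, ∑ j, ∑ n, h j n * h q p * (P q j * Q p n) :=
        Finset.sum_congr rfl fun q _ => Finset.sum_comm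
    _ = _ := by
        refine Finset.sum_congr rfl fun j _ => Finset.sum_congr rfl fun n _ =>
          Finset.sum_congr rfl fun q _ => Finset.sum_congr rfl fun p _ => by ring

/-- Contracting with an antisymmetric form antisymmetrizes the other form. -/
theorem two_mul_dcontr_of_antisymm {P : ι → ι → A} (hP : ∀ j q, P j q = -P q j)
    (Q : ι → ι → A) : 2 * dcontr h P Q = dcontr h P (fun n p => Q n p - Q p n) := by
  rw [dcontr_sub_right]
  have : dcontr h P (fun n p => Q p n) = -dcontr h P Q := by
    rw [← dcontr_swap h P Q, ← dcontr_neg_left]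
    congr 1
    funext j q
    exact hP j q
  rw [this]
  ring

theorem dcontr_eq_zero_of_symm_of_antisymm [Algebra ℝ A] {P Q : ι → ι → A}
    (hP : ∀ j q, P j q = P q j) (hQ : ∀ j q, Q j q = -Q q j) : dcontr h P Q = 0 := by
  apply eq_zero_of_two_mul_eq_zero
  have := dcontr_swap h P Q
  rw [show (fun j q => P q j) = P from funext fun j => funext fun q => hP q j,
    show (fun j q => Q q j) = fun j q => -Q j q from funext fun j => funext fun q => hQ q j,
    dcontr_neg_right] at this
  linear_combination -this

variable {h}

theorem dcontr_tensor (hh : ∀ i j, h i j = h j i) (u w : ι → A) (Q : ι → ι → A) :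
    dcontr h (fun j q => u j * w q) Q = ∑ n, raise h u n * ∑ p, raise h w p * Q n p := by
  unfold dcontr
  rw [Finset.sum_comm]
  refine Finset.sum_congr rfl fun n _ => ?_
  rw [raise, Finset.sum_mul]
  refine Finset.sum_congr rfl fun j _ => ?_
  rw [Finset.sum_comm, Finset.mul_sum]
  refine Finset.sum_congr rfl fun p _ => ?_
  rw [raise, Finset.sum_mul, Finset.mul_sum]
  refine Finset.sum_congr rfl fun q _ => ?_
  rw [hh n j, hh p q]
  ring

theorem contr_sum_raise (hh : ∀ i j, h i j = h j i) (P Q : ι → ι → A) :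
    contr h (fun j n => ∑ p, raise h (P j) p * Q n p) = dcontr h P Q := by
  unfold contr dcontr
  refine Finset.sum_congr rfl fun j _ => Finset.sum_congr rfl fun n _ => ?_
  rw [Finset.sum_comm, Finset.mul_sum]
  refine Finset.sum_congr rfl fun p _ => ?_
  rw [raise, Finset.sum_mul, Finset.mul_sum]
  refine Finset.sum_congr rfl fun q _ => ?_
  rw [hh p q]
  ring

theorem contr_sum_raise_mul (T : ι → ι → ι → A) (u : ι → A) :
    contr h (fun j n => ∑ p, raise h (T j n) p * u p) =
      ∑ p, raise h (fun q => contr h fun j n => T j n q) p * u p := by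
  rw [contr_sum]
  refine Finset.sum_congr rfl fun p _ => ?_
  simp only [mul_comm _ (u p), contr_mul_left]
  congr 1
  simp only [raise, contr_sum, contr_mul_left]

variable [DecidableEq ι] {g : Matrix ι ι A}

theorem dcontr_metric_mul_left (hg : ∀ i j, g i j = g j i) (hh : ∀ i j, h i j = h j i)
    (hgh : h * g = 1) (i : ι) (u : ι → A) (Q : ι → ι → A) :
    dcontr h (fun j q => g i q * u j) Q = ∑ n, raise h u n * Q n i := by
  rw [show (fun j q => g i q * u j) = fun j q => u j * g i q from
    funext fun j => funext fun q => mul_comm _ _, dcontr_tensor hh]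
  simp only [sum_raise_metric_mul hg hgh]

theorem dcontr_metric_mul_right (hg : ∀ i j, g i j = g j i) (hh : ∀ i j, h i j = h j i)
    (hgh : h * g = 1) (k : ι) (u : ι → A) (Q : ι → ι → A) :
    dcontr h (fun j q => u q * g j k) Q = ∑ p, raise h u p * Q k p := by
  rw [← dcontr_metric_mul_left hg hh hgh k u fun p n => Q n p,
    ← dcontr_swap h (fun j q => u q * g j k) Q]
  congr 1
  funext j q
  rw [hg q k, mul_comm]

theorem dcontr_metric (hh : ∀ i j, h i j = h j i) (hgh : h * g = 1) (Q : ι → ι → A) (c : A) :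
    dcontr h (fun j q => g j q * c) Q = c * contr h Q := by
  have key : ∀ n, ∑ j, ∑ q, ∑ p, h j n * h q p * (g j q * c * Q n p) =
      ∑ p, c * (h n p * Q n p) := by
    intro n
    calc _ = ∑ q, ∑ p, (∑ j, h n j * g j q) * (c * (h q p * Q n p)) := by
          rw [Finset.sum_comm]
          refine Finset.sum_congr rfl fun q _ => ?_
          rw [Finset.sum_comm]
          refine Finset.sum_congr rfl fun p _ => ?_
          rw [Finset.sum_mul]
          refine Finset.sum_congr rfl fun j _ => ?_
          rw [hh j n]
          ring
      _ = _ := by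
          simp only [sum_inv_mul hgh]
          rw [Finset.sum_comm]
          simp
  unfold dcontr contr
  rw [Finset.sum_comm]
  simp only [key, Finset.mul_sum]

/-- Separates the part quadratic in `C` from the part containing `L`: every metric factor in `Rd`
collapses the double contraction to a simpler one. -/
theorem dcontr_curvature_decomposition (hg : ∀ i j, g i j = g j i) (hh : ∀ i j, h i j = h j i)
    (hgh : h * g = 1) {C Rd : ι → ι → ι → ι → A} {L : ι → ι → A}
    (hRd : ∀ i j k q, Rd i j k q = C i j k q
      - (g i q * L j k - g j q * L i k + L i q * g j k - L j q * g i k))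
    (hL : ∀ i j, L i j = L j i) (i k : ι) (Q : ι → ι → A) :
    dcontr h (fun j q => Rd i j k q) Q = dcontr h (fun j q => C i j k q) Q
      - (∑ n, raise h (L k) n * Q n i - L i k * contr h Q + ∑ p, raise h (L i) p * Q k p
        - g i k * dcontr h L Q) := by
  simp only [hRd, dcontr_sub_left, dcontr_add_left]
  rw [← dcontr_metric_mul_left hg hh hgh, ← dcontr_metric_mul_right hg hh hgh,
    ← dcontr_metric hh hgh, ← dcontr_mul_left]
  simp only [hL _ k, mul_comm (L _ _) (g i k)]

end DoubleContraction

/-! ### The contracted commutator identity. -/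

section Commutator

variable {A : Type*} [CommRing A] [Algebra ℝ A] {ι : Type*} [Fintype ι] {h : Matrix ι ι A}
  {C : ι → ι → ι → ι → A}

/-- Bianchi turns the difference of the first factors into `C i k j q`. This is antisymmetric in
`j`, `q`, so only the antisymmetric part of the second factor survives, and Bianchi rewrites that as
well. -/
theorem two_mul_dcontr_curvature_sub (hC : IsCurvatureLike C) (i k l m : ι) :
    2 * (dcontr h (fun j q => C i j k q) (fun n p => C p l m n)
      - dcontr h (fun j q => C k j i q) (fun n p => C p l m n)) =
    dcontr h (fun j q => C i k j q) (fun n p => C l m n p) := by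
  rw [← dcontr_sub_left]
  simp only [hC.antisymmetrize i]
  rw [two_mul_dcontr_of_antisymm h (hC.antisymm_right i k)]
  congr 1
  funext n p
  linear_combination hC.antisymmetrize' l p n m + hC.antisymm_left p l m n
    - hC.antisymm_right l p m n - hC.antisymm_left n l m p + hC.antisymm_right l n m p

theorem two_mul_dcontr_curvature (hh : ∀ i j, h i j = h j i) (hC : IsCurvatureLike C) (i m k l : ι) :
    2 * dcontr h (fun j q => C i j m q) (fun n p => C k l p n) =
    -dcontr h (fun j q => C i m j q) (fun n p => C k l n p) := by
  rw [dcontr_comm h hh, two_mul_dcontr_of_antisymm h fun j q => hC.antisymm_right k l q j]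
  simp only [hC.antisymmetrize' i]
  rw [dcontr_comm h hh, ← dcontr_neg_right]
  congr 1
  funext n p
  exact hC.antisymm_right k l p n

/-- The terms of the commutator identity that are quadratic in the Weyl tensor cancel. -/
theorem dcontr_curvature_cyclic (hh : ∀ i j, h i j = h j i) (hC : IsCurvatureLike C)
    (i k l m : ι) :
    (dcontr h (fun j q => C i j k q) (fun n p => C p l m n)
      + dcontr h (fun j q => C i j l q) (fun n p => C k p m n)
      + dcontr h (fun j q => C i j m q) (fun n p => C k l p n))
    + (dcontr h (fun j q => C k j l q) (fun n p => C p i m n)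
      + dcontr h (fun j q => C k j i q) (fun n p => C l p m n)
      + dcontr h (fun j q => C k j m q) (fun n p => C l i p n))
    + (dcontr h (fun j q => C l j i q) (fun n p => C p k m n)
      + dcontr h (fun j q => C l j k q) (fun n p => C i p m n)
      + dcontr h (fun j q => C l j m q) (fun n p => C i k p n)) = 0 := by
  have hn : ∀ a b c m, dcontr h (fun j q => C a j b q) (fun n p => C c p m n) =
      -dcontr h (fun j q => C a j b q) (fun n p => C p c m n) := by
    intro a b c m
    rw [← dcontr_neg_right]
    congr 1
    funext n p
    exact hC.antisymm_left c p m n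
  apply eq_zero_of_two_mul_eq_zero
  -- After these flips the first six terms form three differences handled by
  -- `two_mul_dcontr_curvature_sub`; they cancel against the three remaining terms by the symmetry
  -- `e` of the double contraction.
  rw [hn i l k, hn k i l, hn l k i]
  have e : ∀ a b c m, dcontr h (fun j q => C a b j q) (fun n p => C c m n p) =
      dcontr h (fun j q => C c m j q) (fun n p => C a b n p) := fun a b c m => dcontr_comm h hh _ _
  linear_combination two_mul_dcontr_curvature_sub (h := h) hC i k l m
    + two_mul_dcontr_curvature_sub (h := h) hC k l i m
    + two_mul_dcontr_curvature_sub (h := h) hC l i k m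
    + two_mul_dcontr_curvature hh hC i m k l + two_mul_dcontr_curvature hh hC k m l i
    + two_mul_dcontr_curvature hh hC l m i k + e i k l m + e k l i m + e l i k m

variable [DecidableEq ι] {g : Matrix ι ι A}

/-- The contracted and antisymmetrized commutator identity for a Weyl tensor which is an
eigentensor of the curvature operators. -/
theorem commutator_compatible (hg : ∀ i j, g i j = g j i) (hh : ∀ i j, h i j = h j i)
    (hgh : h * g = 1) (hC : IsCurvatureLike C)
    (htr : ∀ k l, contr h (fun j m => C j k l m) = 0)
    {Rd : ι → ι → ι → ι → A} {L : ι → ι → A}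
    (hRd : ∀ i j k q, Rd i j k q = C i j k q
      - (g i q * L j k - g j q * L i k + L i q * g j k - L j q * g i k))
    (hL : ∀ i j, L i j = L j i) {w : ι → ι → A}
    (hw : ∀ i j k l m n, w i j * C k l m n =
      (∑ p, raise h (Rd i j k) p * C p l m n) + (∑ p, raise h (Rd i j l) p * C k p m n)
      + (∑ p, raise h (Rd i j m) p * C k l p n) + ∑ p, raise h (Rd i j n) p * C k l m p)
    (i k l m : ι) :
    (∑ p, raise h (w i) p * C k l m p) + (∑ p, raise h (w k) p * C l i m p)
      + (∑ p, raise h (w l) p * C i k m p) +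
    ((Fintype.card ι : A) - 4) * ((∑ p, raise h (L i) p * C k l m p)
      + (∑ p, raise h (L k) p * C l i m p) + ∑ p, raise h (L l) p * C i k m p) = 0 := by
  have htr23 : ∀ i q, contr h (fun j n => C i j n q) = 0 := by
    intro i q
    rw [← htr i q]
    congr 1
    funext j n
    rw [hC.antisymm_left, hC.antisymm_right, neg_neg]
  have htr24 : ∀ i q, contr h (fun j n => C i j q n) = 0 := by
    intro i q
    simp only [hC.antisymm_right i _ q, contr_neg, htr23, neg_zero]
  have htr' : ∀ k l, contr h (fun n p => C p k l n) = 0 := fun k l => by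
    rw [← htr k l, contr_swap h hh fun n p => C n k l p]
  have htr24' : ∀ i q, contr h (fun n p => C i p q n) = 0 := fun k l => by
    rw [← htr24 k l, contr_swap h hh fun n p => C k n l p]
  have hgC : ∀ i j k l, ∑ p, raise h (g i) p * C j k l p = C j k l i :=
    fun i j k l => sum_raise_metric_mul hg hgh i _
  -- This contraction is minus the Ricci tensor, expressed through `L`; it arises when the curvature
  -- acts on the contracted index `n`.
  have hric : ∀ i q, contr h (fun j n => Rd i j n q) =
      -(contr h L * g i q + ((Fintype.card ι : A) - 2) * L i q) := by
    intro i q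
    simp only [hRd, contr_sub, contr_add, htr23, contr_mul_left]
    have e1 : contr h (fun j n => g j q * L i n) = L i q := contr_metric_mul' hg hh hgh q (L i)
    have e2 : contr h (fun j n => L i q * g j n) = Fintype.card ι * L i q := by
      simp only [mul_comm (L i q)]
      exact contr_metric hg hgh _
    have e3 : contr h (fun j n => L j q * g i n) = L i q := by
      simp only [mul_comm _ (g i _)]
      exact contr_metric_mul hg hgh i fun j => L j q
    have e4 : contr h (fun j n => L j n) = contr h L := rfl
    linear_combination e1 - e2 + e3 - g i q * e4
  have hanti : ∀ k l, dcontr h L (fun n p => C k l p n) = 0 := fun k l =>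
    dcontr_eq_zero_of_symm_of_antisymm h hL fun n p => hC.antisymm_right k l p n
  have hcanti : ∀ k l, contr h (fun n p => C k l p n) = 0 := by
    intro k l
    have := contr_swap h hh fun n p => C k l p n
    rw [show (fun m i => C k l m i) = fun m i => -C k l i m from
      funext fun m => funext fun i => hC.antisymm_right k l m i, contr_neg] at this
    exact eq_zero_of_two_mul_eq_zero (by linear_combination -this)
  -- The contraction of `hw` over `j`, `n`, with each `Rd` split into `C` and its `L` part.
  have main : ∀ i k l m, ∑ p, raise h (w i) p * C k l m p =
      dcontr h (fun j q => C i j k q) (fun n p => C p l m n)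
      + dcontr h (fun j q => C i j l q) (fun n p => C k p m n)
      + dcontr h (fun j q => C i j m q) (fun n p => C k l p n)
      - (∑ p, raise h (L k) p * C i l m p + ∑ p, raise h (L i) p * C p l m k
        - g i k * dcontr h L fun n p => C p l m n)
      - (∑ p, raise h (L l) p * C k i m p + ∑ p, raise h (L i) p * C k p m l
        - g i l * dcontr h L fun n p => C k p m n)
      - (∑ p, raise h (L m) p * C k l i p + ∑ p, raise h (L i) p * C k l p m)
      - contr h L * C k l m i
      - ((Fintype.card ι : A) - 2) * ∑ p, raise h (L i) p * C k l m p := by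
    intro i k l m
    have := congrArg (contr h) (funext fun j => funext fun n => hw i j k l m n)
    simp only [contr_add] at this
    rw [contr_mul_apply h hh, contr_sum_raise hh, contr_sum_raise hh, contr_sum_raise hh,
      contr_sum_raise_mul] at this
    rw [this, dcontr_curvature_decomposition hg hh hgh hRd hL,
      dcontr_curvature_decomposition hg hh hgh hRd hL,
      dcontr_curvature_decomposition hg hh hgh hRd hL, htr', htr24', hcanti, hanti]
    have e : ∑ p, raise h (fun q => contr h fun j n => Rd i j n q) p * C k l m p =
        -(contr h L * C k l m i) -
          ((Fintype.card ι : A) - 2) * ∑ p, raise h (L i) p * C k l m p := by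
      rw [← hgC i k l m, Finset.mul_sum, Finset.mul_sum, ← Finset.sum_neg_distrib,
        ← Finset.sum_sub_distrib]
      refine Finset.sum_congr rfl fun p _ => ?_
      have : raise h (fun q => contr h fun j n => Rd i j n q) p =
          -(contr h L * raise h (g i) p) - ((Fintype.card ι : A) - 2) * raise h (L i) p := by
        simp only [raise, hric, Finset.mul_sum, ← Finset.sum_neg_distrib,
          ← Finset.sum_sub_distrib]
        exact Finset.sum_congr rfl fun q _ => by ring
      rw [this]
      ring
    rw [e]
    ring
  have hz : ∀ k m, dcontr h L (fun n p => C k p m n) = -dcontr h L fun n p => C p k m n := by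
    intro k m
    rw [← dcontr_neg_right]
    congr 1
    funext n p
    exact hC.antisymm_left k p m n
  have s1 : ∀ u : ι → A, ∀ k l m, ∑ p, u p * C p l m k + ∑ p, u p * C k p m l =
      ∑ p, u p * C k l m p := by
    intro u k l m
    rw [← Finset.sum_add_distrib]
    refine Finset.sum_congr rfl fun p _ => ?_
    linear_combination u p * (hC.antisymm_right p l m k + hC.antisymm_right k p m l
      - hC.bianchi p l k m + hC.antisymm_left l k p m - hC.antisymm_right k l p m)
  have s2 : ∀ u : ι → A, ∀ k l m, ∑ p, u p * C k l p m = -∑ p, u p * C k l m p := by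
    intro u k l m
    rw [← Finset.sum_neg_distrib]
    exact Finset.sum_congr rfl fun p _ => by rw [hC.antisymm_right k l p m]; ring
  have s3 : ∀ u : ι → A, ∀ k l m, ∑ p, u p * C k l m p = -∑ p, u p * C l k m p := by
    intro u k l m
    rw [← Finset.sum_neg_distrib]
    exact Finset.sum_congr rfl fun p _ => by rw [hC.antisymm_left k l m p]; ring
  have s4 : (∑ p, raise h (L m) p * C k l i p) + (∑ p, raise h (L m) p * C l i k p)
      + ∑ p, raise h (L m) p * C i k l p = 0 := by
    rw [← Finset.sum_add_distrib, ← Finset.sum_add_distrib]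
    refine Finset.sum_eq_zero fun p _ => ?_
    linear_combination raise h (L m) p * hC.bianchi k l i p
  rw [main i k l m, main k l i m, main l i k m, hz k, hz l, hz i]
  have s5 : C k l m i + C l i m k + C i k m l = 0 := by
    linear_combination hC.bianchi_right m i k l + hC.pair_symm k l m i + hC.pair_symm l i m k
      + hC.pair_symm i k m l
  -- In the cyclic sum the terms with `L m`, the trace of `L` and the full contractions with `L`
  -- cancel. Each `L i` acquires two extra copies of its compatibility term, which turns the
  -- coefficient `n - 2` into `n - 4`.
  linear_combination dcontr_curvature_cyclic hh hC i k l m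
    - s1 (raise h (L i)) k l m - s1 (raise h (L k)) l i m - s1 (raise h (L l)) i k m
    - s2 (raise h (L i)) k l m - s2 (raise h (L k)) l i m - s2 (raise h (L l)) i k m
    - 2 * s3 (raise h (L k)) i l m - 2 * s3 (raise h (L l)) k i m - 2 * s3 (raise h (L i)) l k m
    - s4 - contr h L * s5
    + (hg i k) * dcontr h L (fun n p => C p l m n) + (hg k l) * dcontr h L (fun n p => C p i m n)
    + (hg l i) * dcontr h L (fun n p => C p k m n)

end Commutator

/-! ### Connections as matrices over a differential ring: Ricci and Bianchi identities. -/

section Calculus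

open scoped Kronecker

variable {A : Type*} [CommRing A] [Algebra ℝ A] {ι : Type*}

theorem matrix_map_derivation_mul {κ : Type*} [Fintype κ] (D : Derivation ℝ A A)
    (M N : Matrix κ κ A) : (M * N).map D = M.map D * N + M * N.map D := by
  ext i j
  simp only [Matrix.map_apply, Matrix.mul_apply, Matrix.add_apply, map_sum, Derivation.leibniz,
    smul_eq_mul, ← Finset.sum_add_distrib]
  exact Finset.sum_congr rfl fun p _ => by ring

theorem matrix_map_derivation_smul {κ : Type*} (D : Derivation ℝ A A) (c : A)
    (M : Matrix κ κ A) : (c • M).map D = D c • M + c • M.map D := by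
  ext i j
  simp only [Matrix.map_apply, Matrix.smul_apply, Matrix.add_apply, Derivation.leibniz,
    smul_eq_mul]
  ring

theorem matrix_map_derivation_comm {κ : Type*} {D D' : Derivation ℝ A A}
    (h : ∀ f, D (D' f) = D' (D f)) (M : Matrix κ κ A) : (M.map D').map D = (M.map D).map D' := by
  ext i j
  exact h _

/-- The curvature of the connection `∂ - K`. -/
def curvature {κ : Type*} [Fintype κ] (d : ι → Derivation ℝ A A) (K : ι → Matrix κ κ A)
    (j k : ι) : Matrix κ κ A :=
  (K j).map (d k) - (K k).map (d j) + K j * K k - K k * K j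

theorem curvature_antisymm {κ : Type*} [Fintype κ] (d : ι → Derivation ℝ A A)
    (K : ι → Matrix κ κ A) (j k : ι) : curvature d K j k = -curvature d K k j := by
  unfold curvature
  abel

variable {d : ι → Derivation ℝ A A}

/-- The Ricci identity for a recurrent tensor with two indices. -/
theorem recurrent_commutator {κ : Type*} [Fintype κ] [DecidableEq κ]
    (hd : ∀ i j f, d i (d j f) = d j (d i f)) (K : ι → Matrix κ κ A) (M : Matrix κ κ A)
    (a : ι → A) (hM : ∀ i, M.map (d i) = K i * M + M * (K i).transpose + a i • M) (i j : ι) :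
    (d i (a j) - d j (a i)) • M =
      curvature d K i j * M + M * (curvature d K i j).transpose := by
  have key : ∀ i j, (M.map (d j)).map (d i) =
      (K j).map (d i) * M + K j * (K i * M + M * (K i).transpose + a i • M)
      + ((K i * M + M * (K i).transpose + a i • M) * (K j).transpose
        + M * ((K j).map (d i)).transpose)
      + (d i (a j) • M + a j • (K i * M + M * (K i).transpose + a i • M)) := by
    intro i j
    rw [hM j, Matrix.map_add _ (map_add _), Matrix.map_add _ (map_add _),
      matrix_map_derivation_mul, matrix_map_derivation_mul, matrix_map_derivation_smul, hM i,
      Matrix.transpose_map]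
  have h := matrix_map_derivation_comm (hd i j) M
  rw [key, key, ← sub_eq_zero] at h
  rw [← sub_eq_zero, ← h]
  simp only [curvature, Matrix.transpose_add, Matrix.transpose_sub, Matrix.transpose_mul,
    Matrix.add_mul, Matrix.mul_add, Matrix.sub_mul, Matrix.mul_sub, smul_add, sub_smul,
    Matrix.smul_mul, Matrix.mul_smul, Matrix.mul_assoc, smul_smul, mul_comm (a i) (a j)]
  abel

/-- The second Bianchi identity. -/
theorem curvature_bianchi {κ : Type*} [Fintype κ] [DecidableEq κ]
    (hd : ∀ i j f, d i (d j f) = d j (d i f)) (K : ι → Matrix κ κ A) (i j k : ι) :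
    ((curvature d K j k).map (d i) - K i * curvature d K j k + curvature d K j k * K i)
    + ((curvature d K k i).map (d j) - K j * curvature d K k i + curvature d K k i * K j)
    + ((curvature d K i j).map (d k) - K k * curvature d K i j + curvature d K i j * K k) = 0 := by
  simp only [curvature, Matrix.map_add _ (map_add _), Matrix.map_sub _ (map_sub _),
    matrix_map_derivation_mul, matrix_map_derivation_comm (hd i j),
    matrix_map_derivation_comm (hd k i), matrix_map_derivation_comm (hd k j)]
  noncomm_ring

/-- The two summands of the tensor product connection act on different factors and commute, so no
cross terms appear in its curvature. -/
theorem curvature_kronecker [Fintype ι] [DecidableEq ι] (K : ι → Matrix ι ι A) (i j : ι) :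
    curvature d (fun i => K i ⊗ₖ (1 : Matrix ι ι A) + (1 : Matrix ι ι A) ⊗ₖ K i) i j =
      curvature d K i j ⊗ₖ 1 + 1 ⊗ₖ curvature d K i j := by
  have h1 : ∀ i j, (K i ⊗ₖ (1 : Matrix ι ι A)).map (d j) = (K i).map (d j) ⊗ₖ 1 := by
    intro i j
    ext ⟨a, b⟩ ⟨c, e⟩
    by_cases hbe : b = e <;> simp [hbe]
  have h2 : ∀ i j, ((1 : Matrix ι ι A) ⊗ₖ K i).map (d j) = 1 ⊗ₖ (K i).map (d j) := by
    intro i j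
    ext ⟨a, b⟩ ⟨c, e⟩
    by_cases hbe : a = c <;> simp [hbe]
  simp only [curvature, Matrix.map_add _ (map_add _), h1, h2, Matrix.add_mul, Matrix.mul_add,
    ← Matrix.mul_kronecker_mul, Matrix.one_mul, Matrix.mul_one, sub_eq_add_neg,
    Matrix.add_kronecker, Matrix.kronecker_add]
  have h3 : ∀ M : Matrix ι ι A, (-M) ⊗ₖ (1 : Matrix ι ι A) = -(M ⊗ₖ 1) := by
    intro M; ext ⟨a, b⟩ ⟨c, e⟩; simp
  have h4 : ∀ M : Matrix ι ι A, (1 : Matrix ι ι A) ⊗ₖ (-M) = -(1 ⊗ₖ M) := by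
    intro M; ext ⟨a, b⟩ ⟨c, e⟩; simp
  simp only [h3, h4]
  abel

/-- The Ricci identity for a recurrent tensor with four indices. -/
theorem recurrent_commutator_four [Fintype ι] [DecidableEq ι]
    (hd : ∀ i j f, d i (d j f) = d j (d i f)) (K : ι → Matrix ι ι A)
    {C : ι → ι → ι → ι → A} {a : ι → A}
    (hC : ∀ i j k l m, d i (C j k l m) = (∑ p, (K i j p * C p k l m + K i k p * C j p l m
      + K i l p * C j k p m + K i m p * C j k l p)) + a i * C j k l m) (i j k l m n : ι) :
    (d i (a j) - d j (a i)) * C k l m n =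
      (∑ p, curvature d K i j k p * C p l m n) + (∑ p, curvature d K i j l p * C k p m n)
      + (∑ p, curvature d K i j m p * C k l p n) + ∑ p, curvature d K i j n p * C k l m p := by
  have mul_l : ∀ (N : Matrix ι ι A) (k l m n : ι),
      ((N ⊗ₖ (1 : Matrix ι ι A) + (1 : Matrix ι ι A) ⊗ₖ N) *
        (Matrix.of fun x y : ι × ι => C x.1 x.2 y.1 y.2)) (k, l) (m, n) =
      (∑ p, N k p * C p l m n) + ∑ p, N l p * C k p m n := by
    intro N k l m n
    rw [Matrix.add_mul, Matrix.add_apply, Matrix.mul_apply, Matrix.mul_apply,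
      Fintype.sum_prod_type, Fintype.sum_prod_type]
    simp [Matrix.one_apply]
  have mul_r : ∀ (N : Matrix ι ι A) (k l m n : ι),
      ((Matrix.of fun x y : ι × ι => C x.1 x.2 y.1 y.2) *
        (N ⊗ₖ (1 : Matrix ι ι A) + (1 : Matrix ι ι A) ⊗ₖ N).transpose) (k, l) (m, n) =
      (∑ p, N m p * C k l p n) + ∑ p, N n p * C k l m p := by
    intro N k l m n
    rw [Matrix.transpose_add, Matrix.mul_add, Matrix.add_apply, Matrix.mul_apply, Matrix.mul_apply,
      Fintype.sum_prod_type, Fintype.sum_prod_type]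
    simp [Matrix.one_apply, mul_comm]
  -- A 4-tensor is a matrix indexed by pairs, so the two-index identity applies with the connection
  -- on pairs.
  have := recurrent_commutator hd (fun i => K i ⊗ₖ (1 : Matrix ι ι A) + (1 : Matrix ι ι A) ⊗ₖ K i)
    (Matrix.of fun x y : ι × ι => C x.1 x.2 y.1 y.2) a (by
      intro i
      ext ⟨j, k⟩ ⟨l, m⟩
      rw [Matrix.add_apply, Matrix.add_apply, mul_l, mul_r]
      simp only [Matrix.map_apply, Matrix.of_apply, hC, Finset.sum_add_distrib, Matrix.smul_apply,
        smul_eq_mul]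
      ring) i j
  have := congrFun (congrFun this (k, l)) (m, n)
  rw [curvature_kronecker, Matrix.add_apply, mul_l, mul_r] at this
  simp only [Matrix.smul_apply, Matrix.of_apply, smul_eq_mul] at this
  rw [this]
  ring

end Calculus

/-! ### The Riemann tensor of a torsion-free metric connection. -/

section LeviCivita

variable {A : Type*} [CommRing A] [Algebra ℝ A] {ι : Type*} [Fintype ι]
  {d : ι → Derivation ℝ A A} {K : ι → Matrix ι ι A} {g h : Matrix ι ι A}

/-- The Riemann tensor of the connection with Christoffel symbols `K`, with lowered index. -/
def riemannDown (d : ι → Derivation ℝ A A) (K : ι → Matrix ι ι A) (g : Matrix ι ι A)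
    (j k l m : ι) : A :=
  (curvature d K j k * g) l m

theorem riemannDown_isCurvatureLike [DecidableEq ι] (hd : ∀ i j f, d i (d j f) = d j (d i f))
    (hg : ∀ i j, g i j = g j i) (hK : ∀ i j k, K i j k = K j i k)
    (hKg : ∀ i, g.map (d i) = K i * g + g * (K i).transpose) :
    IsCurvatureLike (riemannDown d K g) where
  antisymm_left := by
    intro j k l m
    rw [riemannDown, curvature_antisymm, Matrix.neg_mul]
    rfl
  antisymm_right := by
    intro j k l m
    -- A parallel metric is recurrent with zero recurrence vector; the Ricci identity then makes the
    -- lowered curvature antisymmetric.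
    have h1 := recurrent_commutator hd K g (fun _ => 0) (by simpa using hKg) j k
    have hgt : g.transpose = g := by ext a b; exact hg b a
    have h2 : g * (curvature d K j k).transpose = (curvature d K j k * g).transpose := by
      rw [Matrix.transpose_mul, hgt]
    rw [h2] at h1
    have := congrFun (congrFun h1 l) m
    simp only [map_zero, sub_zero, zero_smul, Matrix.zero_apply, Matrix.add_apply,
      Matrix.transpose_apply] at this
    exact eq_neg_of_add_eq_zero_left this.symm
  bianchi := by
    intro j k l m
    have h1 : ∀ p, curvature d K j k l p + curvature d K k l j p + curvature d K l j k p = 0 := by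
      intro p
      simp only [curvature, Matrix.sub_apply, Matrix.add_apply, Matrix.map_apply, Matrix.mul_apply]
      rw [hK k j p, hK l k p, hK l j p]
      have e : ∀ a b c, ∑ q, K a b q * K c q p = ∑ q, K b a q * K c q p := fun a b c =>
        Finset.sum_congr rfl fun q _ => by rw [hK]
      rw [e k j, e l k, e l j]
      ring
    simp only [riemannDown, Matrix.mul_apply, ← Finset.sum_add_distrib]
    refine Finset.sum_eq_zero fun p _ => ?_
    rw [← add_mul, ← add_mul, h1, zero_mul]

/-- The covariant derivative of a covector, without the term for the direction of derivation. -/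
def covD (d : ι → Derivation ℝ A A) (K : ι → Matrix ι ι A) (i : ι) (v : ι → A) (l : ι) : A :=
  d i (v l) - ∑ p, K i l p * v p

/-- The covariant derivative of a tensor with two indices. -/
def covD₂ (d : ι → Derivation ℝ A A) (K : ι → Matrix ι ι A) (i : ι) (T : ι → ι → A)
    (l m : ι) : A :=
  d i (T l m) - ∑ p, (K i l p * T p m + K i m p * T l p)

theorem covD₂_tensor (i : ι) (u v : ι → A) (l m : ι) :
    covD₂ d K i (fun l m => u l * v m) l m = covD d K i u l * v m + u l * covD d K i v m := by
  simp only [covD₂, covD, Derivation.leibniz, smul_eq_mul, Finset.sum_add_distrib, sub_mul, mul_sub,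
    Finset.sum_mul, Finset.mul_sum]
  have e : ∑ p, K i m p * (u l * v p) = ∑ p, u l * (K i m p * v p) :=
    Finset.sum_congr rfl fun p _ => by ring
  have e' : ∑ p, K i l p * (u p * v m) = ∑ p, K i l p * u p * v m :=
    Finset.sum_congr rfl fun p _ => by ring
  rw [e, e']
  ring

theorem covD₂_add (i : ι) (S T : ι → ι → A) (l m : ι) :
    covD₂ d K i (fun l m => S l m + T l m) l m = covD₂ d K i S l m + covD₂ d K i T l m := by
  simp only [covD₂, map_add, mul_add, Finset.sum_add_distrib]
  ring

theorem covD₂_sub (i : ι) (S T : ι → ι → A) (l m : ι) :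
    covD₂ d K i (fun l m => S l m - T l m) l m = covD₂ d K i S l m - covD₂ d K i T l m := by
  simp only [covD₂, map_sub, mul_sub, Finset.sum_add_distrib, Finset.sum_sub_distrib]
  ring

theorem covD_sub (i : ι) (u v : ι → A) (l : ι) :
    covD d K i (fun l => u l - v l) l = covD d K i u l - covD d K i v l := by
  simp only [covD, map_sub, mul_sub, Finset.sum_sub_distrib]
  ring

/-- The index `j` of `g j` is not differentiated covariantly here, so parallelism leaves the term
`Γ_{ij}^p g_{pm}`, symmetric in `i`, `j` since there is no torsion. -/
theorem covD_metric_symm (hK : ∀ i j k, K i j k = K j i k)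
    (hKg : ∀ i, g.map (d i) = K i * g + g * (K i).transpose) (i j m : ι) :
    covD d K i (g j) m = covD d K j (g i) m := by
  have key : ∀ i j, covD d K i (g j) m = ∑ p, K i j p * g p m := by
    intro i j
    have := congrFun (congrFun (hKg i) j) m
    simp only [Matrix.map_apply, Matrix.add_apply, Matrix.mul_apply, Matrix.transpose_apply] at this
    rw [covD, this, add_sub_assoc, ← Finset.sum_sub_distrib]
    simp [mul_comm]
  rw [key, key]
  exact Finset.sum_congr rfl fun p _ => by rw [hK]

/-- Since `g` is parallel, lowering an index commutes with differentiation, and the matrix identity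
`curvature_bianchi` can be multiplied by `g`. -/
theorem riemannDown_bianchi [DecidableEq ι] (hd : ∀ i j f, d i (d j f) = d j (d i f))
    (hKg : ∀ i, g.map (d i) = K i * g + g * (K i).transpose) (i j k l m : ι) :
    covD₂ d K i (riemannDown d K g j k) l m + covD₂ d K j (riemannDown d K g k i) l m
      + covD₂ d K k (riemannDown d K g i j) l m = 0 := by
  have key : ∀ i j k, covD₂ d K i (riemannDown d K g j k) l m =
      (((curvature d K j k).map (d i) - K i * curvature d K j k + curvature d K j k * K i) * g)
        l m := by
    intro i j k
    have h1 : covD₂ d K i (riemannDown d K g j k) l m =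
        ((curvature d K j k * g).map (d i) - K i * (curvature d K j k * g)
          - curvature d K j k * g * (K i).transpose) l m := by
      simp only [covD₂, riemannDown, Matrix.sub_apply, Matrix.map_apply, Matrix.mul_apply (M := K i),
        Matrix.mul_apply (N := (K i).transpose), Matrix.transpose_apply, Finset.sum_add_distrib]
      rw [sub_add_eq_sub_sub]
      congr 1
      exact Finset.sum_congr rfl fun p _ => mul_comm _ _
    rw [h1, matrix_map_derivation_mul, hKg]
    refine congrFun (congrFun (?_ : (_ : Matrix ι ι A) = _) l) m
    simp only [Matrix.add_mul, Matrix.sub_mul, Matrix.mul_add, Matrix.mul_assoc]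
    abel
  rw [key, key, key, ← Matrix.add_apply, ← Matrix.add_apply, ← Matrix.add_mul, ← Matrix.add_mul,
    curvature_bianchi hd, Matrix.zero_mul, Matrix.zero_apply]

/-- The Ricci identity. No torsion term can occur, because `covD` does not act on the index of the
direction of derivation. -/
theorem covD_commutator (hd : ∀ i j f, d i (d j f) = d j (d i f)) (i k : ι) (v : ι → A) (l : ι) :
    covD d K i (covD d K k v) l - covD d K k (covD d K i v) l =
      ∑ p, curvature d K i k l p * v p := by
  have key : ∀ i k, covD d K i (covD d K k v) l = d i (d k (v l))
      - (∑ p, d i (K k l p) * v p) - (∑ p, K k l p * d i (v p)) - (∑ p, K i l p * d k (v p))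
      + ∑ p, (K i * K k) l p * v p := by
    intro i k
    have e : ∑ p, (K i * K k) l p * v p = ∑ p, K i l p * ∑ q, K k p q * v q := by
      simp only [Matrix.mul_apply, Finset.sum_mul, Finset.mul_sum, mul_assoc]
      rw [Finset.sum_comm]
    rw [e]
    simp only [covD, map_sub, map_sum, Derivation.leibniz, smul_eq_mul, mul_sub,
      Finset.sum_sub_distrib, Finset.sum_add_distrib, mul_comm (v _)]
    ring
  have e : ∑ p, curvature d K i k l p * v p = (∑ p, d k (K i l p) * v p)
      - (∑ p, d i (K k l p) * v p) + (∑ p, (K i * K k) l p * v p)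
      - ∑ p, (K k * K i) l p * v p := by
    simp only [← Finset.sum_add_distrib, ← Finset.sum_sub_distrib]
    refine Finset.sum_congr rfl fun p _ => ?_
    simp only [curvature, Matrix.sub_apply, Matrix.add_apply, Matrix.map_apply]
    ring
  rw [key, key, e, hd k i]
  ring

end LeviCivita

/-! ### Products with the metric and the compatibility sum. -/

section MetricProduct

variable {A : Type*} [CommRing A] {ι : Type*} {g h : Matrix ι ι A}

/-- The Kulkarni–Nomizu type product of the metric with a symmetric form. -/
def metricProd (g : Matrix ι ι A) (L : ι → ι → A) (j k l m : ι) : A :=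
  g j m * L k l - g k m * L j l + L j m * g k l - L k m * g j l

theorem metricProd_isCurvatureLike (hg : ∀ i j, g i j = g j i) {L : ι → ι → A}
    (hL : ∀ i j, L i j = L j i) : IsCurvatureLike (metricProd g L) where
  antisymm_left := by intro j k l m; simp only [metricProd]; ring
  antisymm_right := by
    intro j k l m
    simp only [metricProd]
    ring
  bianchi := by
    intro j k l m
    simp only [metricProd]
    rw [hg k j, hg l j, hg l k, hL k j, hL l j, hL l k]
    ring

theorem IsCurvatureLike.add {C D : ι → ι → ι → ι → A} (hC : IsCurvatureLike C)
    (hD : IsCurvatureLike D) : IsCurvatureLike (fun j k l m => C j k l m + D j k l m) where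
  antisymm_left j k l m := by rw [hC.antisymm_left, hD.antisymm_left]; ring
  antisymm_right j k l m := by rw [hC.antisymm_right, hD.antisymm_right]; ring
  bianchi j k l m := by linear_combination hC.bianchi j k l m + hD.bianchi j k l m

variable [Fintype ι]

theorem contr_metricProd [DecidableEq ι] (hg : ∀ i j, g i j = g j i) (hh : ∀ i j, h i j = h j i)
    (hgh : h * g = 1) (L : ι → ι → A) (k l : ι) :
    contr h (fun j m => metricProd g L j k l m) =
      ((Fintype.card ι : A) - 2) * L k l + contr h L * g k l := by
  have e1 : contr h (fun j m => g j m * L k l) = Fintype.card ι * L k l := contr_metric hg hgh _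
  have e2 : contr h (fun j m => g k m * L j l) = L k l := contr_metric_mul hg hgh k _
  have e3 : contr h (fun j m => L j m * g k l) = contr h L * g k l := by
    simp only [mul_comm _ (g k l), contr_mul_left]
  have e4 : contr h (fun j m => L k m * g j l) = L k l := by
    simp only [mul_comm (L k _)]
    exact contr_metric_mul' hg hh hgh l _
  simp only [metricProd, contr_add, contr_sub]
  linear_combination e1 - e2 + e3 - e4

/-- The cyclic sum whose vanishing expresses that `b` is compatible with `C`. -/
def compatSum (h : Matrix ι ι A) (C : ι → ι → ι → ι → A) (b : ι → ι → A) (i j k l : ι) : A :=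
  (∑ q, raise h (b i) q * C j k l q) + (∑ q, raise h (b j) q * C k i l q)
    + ∑ q, raise h (b k) q * C i j l q

theorem compatSum_add (C : ι → ι → ι → ι → A) (b b' : ι → ι → A) (i j k l : ι) :
    compatSum h C (fun i j => b i j + b' i j) i j k l =
      compatSum h C b i j k l + compatSum h C b' i j k l := by
  simp only [compatSum, raise, mul_add, Finset.sum_add_distrib, add_mul]
  ring

theorem compatSum_mul_left (C : ι → ι → ι → ι → A) (c : A) (b : ι → ι → A) (i j k l : ι) :
    compatSum h C (fun i j => c * b i j) i j k l = c * compatSum h C b i j k l := by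
  have e : ∀ i q, raise h (fun j => c * b i j) q = c * raise h (b i) q := by
    intro i q
    simp only [raise, Finset.mul_sum]
    exact Finset.sum_congr rfl fun p _ => by ring
  simp only [compatSum, e, mul_assoc, ← Finset.mul_sum]
  ring

theorem compatSum_sub_tensor (C D : ι → ι → ι → ι → A) (b : ι → ι → A) (i j k l : ι) :
    compatSum h (fun j k l m => C j k l m - D j k l m) b i j k l =
      compatSum h C b i j k l - compatSum h D b i j k l := by
  simp only [compatSum, mul_sub, Finset.sum_sub_distrib]
  ring

theorem sum_raise_mul_comm (hh : ∀ i j, h i j = h j i) (u v : ι → A) :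
    ∑ q, raise h u q * v q = ∑ q, raise h v q * u q := by
  rw [← contr_mul_apply h hh, ← contr_mul_apply h hh, ← contr_swap h hh]
  simp only [mul_comm]

/-- The contractions yield products `L_{ij} L_{kl}` and the square `L_i^q L_{jq}`; both are
symmetric in `i`, `j` and cancel cyclically. This lets Weyl and Riemann be exchanged in the
compatibility sum of `L`. -/
theorem compatSum_metricProd [DecidableEq ι] (hh : ∀ i j, h i j = h j i) (hgh : g * h = 1)
    {L : ι → ι → A} (hL : ∀ i j, L i j = L j i)
    (i j k l : ι) : compatSum h (metricProd g L) L i j k l = 0 := by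
  have e : ∀ i j k l, ∑ q, raise h (L i) q * metricProd g L j k l q =
      L i j * L k l - L i k * L j l + (∑ q, raise h (L i) q * L j q) * g k l
        - (∑ q, raise h (L i) q * L k q) * g j l := by
    intro i j k l
    rw [← sum_raise_mul_metric hgh (L i) j, ← sum_raise_mul_metric hgh (L i) k]
    simp only [Finset.sum_mul, ← Finset.sum_add_distrib, ← Finset.sum_sub_distrib]
    exact Finset.sum_congr rfl fun q _ => by rw [metricProd]; ring
  have s := fun i j => sum_raise_mul_comm hh (L i) (L j)
  simp only [compatSum, e]
  rw [s j i, s k i, s k j, hL j i, hL k i, hL k j]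
  ring

theorem raise_lower [DecidableEq ι] (hgh : h * g = 1) (v : ι → A)
    (q : ι) : raise h (fun m => ∑ p, v p * g m p) q = v q := by
  have : ∀ p, ∑ m, h q m * (v p * g m p) = if q = p then v p else 0 := by
    intro p
    calc _ = (∑ m, h q m * g m p) * v p := by
          rw [Finset.sum_mul]
          exact Finset.sum_congr rfl fun m _ => by ring
      _ = _ := by rw [sum_inv_mul hgh]; split_ifs <;> simp
  simp only [raise, Finset.mul_sum]
  rw [Finset.sum_comm]
  simp [this]

/-- Justifies the partial derivatives `covD` and `covD₂`: in a cyclic sum the connection terms on an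
antisymmetric pair cancel for a torsion-free connection. -/
theorem sum_connection_cyclic {K : ι → Matrix ι ι A} (hK : ∀ i j k, K i j k = K j i k) {T : ι → ι → A}
    (hT : ∀ j k, T j k = -T k j) (i j k : ι) :
    (∑ p, (K i j p * T p k + K i k p * T j p)) + (∑ p, (K j k p * T p i + K j i p * T k p))
      + ∑ p, (K k i p * T p j + K k j p * T i p) = 0 := by
  simp only [← Finset.sum_add_distrib]
  refine Finset.sum_eq_zero fun p _ => ?_
  rw [hK j i, hK k i, hK k j, hT p k, hT p i, hT p j]
  ring

end MetricProduct

/-! ### Compatibility of the recurrence vector and the Schouten tensor. -/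

section ConformallyRecurrent

variable {A : Type*} [CommRing A] [Algebra ℝ A] {ι : Type*} [Fintype ι]
  {d : ι → Derivation ℝ A A} {K : ι → Matrix ι ι A} {g h : Matrix ι ι A}

/-- By the Leibniz rule, the derivatives of `g` cancel through `covD_metric_symm` and those of `L`
pair up into `X`, the Cotton tensor when `L` is the Schouten tensor. -/
theorem covD₂_metricProd_cyclic (hK : ∀ i j k, K i j k = K j i k)
    (hKg : ∀ i, g.map (d i) = K i * g + g * (K i).transpose) (L : ι → ι → A) (i j k l m : ι)
    {X : ι → ι → ι → A} (hX : ∀ j k l, X j k l = covD d K k (L j) l - covD d K j (L k) l) :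
    covD₂ d K i (fun l m => g j m * L k l - g k m * L j l + L j m * g k l - L k m * g j l) l m
    + covD₂ d K j (fun l m => g k m * L i l - g i m * L k l + L k m * g i l - L i m * g k l) l m
    + covD₂ d K k (fun l m => g i m * L j l - g j m * L i l + L i m * g j l - L j m * g i l) l m
    = g i m * X j k l + g j m * X k i l + g k m * X i j l
        - (g i l * X j k m + g j l * X k i m + g k l * X i j m) := by
  have e : ∀ i j k, covD₂ d K i
      (fun l m => g j m * L k l - g k m * L j l + L j m * g k l - L k m * g j l) l m =
      (covD d K i (L k) l * g j m + L k l * covD d K i (g j) m)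
      - (covD d K i (L j) l * g k m + L j l * covD d K i (g k) m)
      + (covD d K i (g k) l * L j m + g k l * covD d K i (L j) m)
      - (covD d K i (g j) l * L k m + g j l * covD d K i (L k) m) := by
    intro i j k
    simp only [← covD₂_tensor]
    rw [← covD₂_sub, ← covD₂_add, ← covD₂_sub]
    exact congrArg (fun T : ι → ι → A => covD₂ d K i T l m)
      (funext fun l => funext fun m => by ring)
  rw [e, e, e]
  simp only [hX]
  have s := fun a b m => covD_metric_symm (d := d) (g := g) hK hKg a b m
  linear_combination L k l * s i j m - L j l * s i k m + L i l * s j k m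
    + L j m * s i k l - L k m * s i j l - L i m * s j k l

/-- The recurrence condition for the covariant Weyl tensor. -/
def IsRecurrent (d : ι → Derivation ℝ A A) (K : ι → Matrix ι ι A) (a : ι → A)
    (C : ι → ι → ι → ι → A) : Prop :=
  ∀ i j k l m, d i (C j k l m) = (∑ p, (K i j p * C p k l m + K i k p * C j p l m
      + K i l p * C j k p m + K i m p * C j k l p)) + a i * C j k l m

theorem IsRecurrent.covD₂_cyclic {a : ι → A} {C : ι → ι → ι → ι → A}
    (hK : ∀ i j k, K i j k = K j i k) (hC : IsCurvatureLike C) (hrec : IsRecurrent d K a C)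
    (i j k l m : ι) :
    covD₂ d K i (C j k) l m + covD₂ d K j (C k i) l m + covD₂ d K k (C i j) l m =
      a i * C j k l m + a j * C k i l m + a k * C i j l m := by
  have h1 := sum_connection_cyclic hK (fun j k => hC.antisymm_left j k l m) i j k
  simp only [covD₂, hrec i, hrec j, hrec k, Finset.sum_add_distrib] at h1 ⊢
  linear_combination h1


/-- The covariant derivative commutes with lowering an index. -/
theorem covD_eq_sum_metric_mul (hKg : ∀ i, g.map (d i) = K i * g + g * (K i).transpose)
    {a v : ι → A} (hv : ∀ m, a m = ∑ q, v q * g m q) (i m : ι) :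
    covD d K i a m = ∑ q, (d i (v q) + ∑ r, K i r q * v r) * g m q := by
  have h1 : ∀ q, d i (g m q) = (∑ p, K i m p * g p q) + ∑ p, g m p * K i q p := by
    intro q
    have := congrFun (congrFun (hKg i) m) q
    simpa only [Matrix.map_apply, Matrix.add_apply, Matrix.mul_apply,
      Matrix.transpose_apply] using this
  have h2 : ∑ p, K i m p * a p = ∑ q, v q * ∑ p, K i m p * g p q := by
    simp only [hv, Finset.mul_sum]
    rw [Finset.sum_comm]
    exact Finset.sum_congr rfl fun q _ => Finset.sum_congr rfl fun p _ => by ring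
  have h3 : ∑ q, v q * ∑ p, g m p * K i q p = ∑ q, (∑ r, K i r q * v r) * g m q := by
    simp only [Finset.mul_sum, Finset.sum_mul]
    rw [Finset.sum_comm]
    exact Finset.sum_congr rfl fun q _ => Finset.sum_congr rfl fun p _ => by ring
  rw [covD, h2, hv]
  simp only [map_sum, Derivation.leibniz, smul_eq_mul, h1, mul_add, add_mul,
    Finset.sum_add_distrib, h3]
  simp only [mul_comm (d i (v _))]
  ring

theorem raise_covD [DecidableEq ι] (hgh : h * g = 1) (hgh' : g * h = 1)
    (hKg : ∀ i, g.map (d i) = K i * g + g * (K i).transpose) (a : ι → A) (i q : ι) :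
    raise h (covD d K i a) q = d i (raise h a q) + ∑ r, K i r q * raise h a r := by
  have h1 := covD_eq_sum_metric_mul hKg (v := raise h a)
    (fun m => (sum_raise_mul_metric hgh' a m).symm) i
  rw [show covD d K i a = _ from funext h1, raise_lower hgh]

/-- The product rule for `∇_i (v^q C_{jklq})`. The last sum holds the connection terms on `j`, `k`,
which `covD` omits and which later cancel cyclically. -/
theorem IsRecurrent.covD_contraction {a : ι → A} {C : ι → ι → ι → ι → A}
    (hrec : IsRecurrent d K a C) (v : ι → A) (i j k l : ι) :
    covD d K i (fun l => ∑ q, v q * C j k l q) l =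
      (∑ q, (d i (v q) + ∑ r, K i r q * v r) * C j k l q) + a i * (∑ q, v q * C j k l q)
      + ∑ p, (K i j p * (∑ q, v q * C p k l q) + K i k p * ∑ q, v q * C j p l q) := by
  have swap : ∀ (B : ι → A) (T : ι → ι → A),
      ∑ q, v q * ∑ p, B p * T p q = ∑ p, B p * ∑ q, v q * T p q := by
    intro B T
    simp only [Finset.mul_sum]
    rw [Finset.sum_comm]
    exact Finset.sum_congr rfl fun p _ => Finset.sum_congr rfl fun q _ => by ring
  have h5 : ∑ q, v q * ∑ p, K i q p * C j k l p = ∑ q, (∑ r, K i r q * v r) * C j k l q := by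
    simp only [Finset.mul_sum, Finset.sum_mul]
    rw [Finset.sum_comm]
    exact Finset.sum_congr rfl fun p _ => Finset.sum_congr rfl fun q _ => by ring
  have h6 : ∑ q, v q * (a i * C j k l q) = a i * ∑ q, v q * C j k l q := by
    rw [Finset.mul_sum]
    exact Finset.sum_congr rfl fun q _ => by ring
  have h7 : ∑ q, C j k l q * d i (v q) = ∑ q, d i (v q) * C j k l q :=
    Finset.sum_congr rfl fun q _ => mul_comm _ _
  simp only [covD, map_sum, Derivation.leibniz, smul_eq_mul, hrec i, mul_add, add_mul,
    Finset.sum_add_distrib, swap, h5, h6, h7]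
  ring

/-- Compatibility of the recurrence covector, its derivative and the Schouten tensor `L` with a
recurrent Weyl tensor. -/
theorem IsRecurrent.compatSum_eq_zero [DecidableEq ι] (hd : ∀ i j f, d i (d j f) = d j (d i f))
    (hg : ∀ i j, g i j = g j i) (hh : ∀ i j, h i j = h j i) (hgh : h * g = 1) (hgh' : g * h = 1)
    (hn : 5 ≤ Fintype.card ι) (hK : ∀ i j k, K i j k = K j i k)
    (hKg : ∀ i, g.map (d i) = K i * g + g * (K i).transpose)
    {L : ι → ι → A} (hL : ∀ i j, L i j = L j i) {C : ι → ι → ι → ι → A}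
    (hC : ∀ j k l m, C j k l m = riemannDown d K g j k l m + metricProd g L j k l m)
    (htr : ∀ k l, contr h (fun j m => C j k l m) = 0) {a : ι → A} (hrec : IsRecurrent d K a C)
    (i j k l : ι) :
    compatSum h C (fun i j => a i * a j) i j k l = 0 ∧
    compatSum h C (fun i j => covD d K i a j + ((Fintype.card ι : A) - 3) * L i j) i j k l = 0 ∧
    compatSum h C (fun i j => covD d K i a j - covD d K j a i
      + ((Fintype.card ι : A) - 4) * L i j) i j k l = 0 := by
  have hR := riemannDown_isCurvatureLike hd hg hK hKg
  have hCc : IsCurvatureLike C := by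
    have := hR.add (metricProd_isCurvatureLike hg hL)
    simpa only [← hC] using this
  have hFu : ∀ i j k p, curvature d K i j k p = raise h (riemannDown d K g i j k) p := by
    intro i j k p
    rw [← raise_lower hgh (fun p => curvature d K i j k p) p]
    congr 1
    funext m
    rw [riemannDown, Matrix.mul_apply]
    exact Finset.sum_congr rfl fun q _ => by rw [hg m q]
  set X : ι → ι → ι → A := fun j k l => covD d K k (L j) l - covD d K j (L k) l with hX
  have hXa : ∀ j k l, X j k l = -X k j l := fun j k l => by simp only [hX]; ring
  have hE : ∀ i j k l m, a i * C j k l m + a j * C k i l m + a k * C i j l m =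
      g i m * X j k l + g j m * X k i l + g k m * X i j l
        - (g i l * X j k m + g j l * X k i m + g k l * X i j m) := by
    intro i j k l m
    rw [← hrec.covD₂_cyclic hK hCc, ← covD₂_metricProd_cyclic hK hKg L i j k l m
      (fun _ _ _ => rfl)]
    have e : ∀ i j k, covD₂ d K i (C j k) l m = covD₂ d K i (riemannDown d K g j k) l m
        + covD₂ d K i (metricProd g L j k) l m := by
      intro i j k
      rw [← covD₂_add]
      exact congrArg (fun T : ι → ι → A => covD₂ d K i T l m)
        (funext fun l => funext fun m => hC j k l m)
    rw [e, e, e]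
    have := riemannDown_bianchi hd hKg i j k l m
    unfold metricProd
    linear_combination this
  have hXC := trace_recurrent_bianchi hg hh hgh hn hCc htr hXa hE
  have h1 := recurrent_sq_compatible hgh' hn hCc hE hXC
  refine ⟨?_, ?_, ?_⟩
  · rw [← h1 i j k l]
    have e : ∀ i q, raise h (fun j => a i * a j) q = a i * raise h a q := by
      intro i q
      simp only [raise, Finset.mul_sum]
      exact Finset.sum_congr rfl fun p _ => by ring
    simp only [compatSum, e, Finset.mul_sum, mul_assoc]
  · have h2 : covD d K i (X j k) l + covD d K j (X k i) l + covD d K k (X i j) l =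
        -compatSum h C L i j k l := by
      have e1 : ∀ i j k l, ∑ p, curvature d K j k l p * L i p =
          ∑ q, raise h (L i) q * (C j k l q - metricProd g L j k l q) := by
        intro i j k l
        simp only [hFu, hC, add_sub_cancel_right]
        exact sum_raise_mul_comm hh _ _
      have e2 := compatSum_metricProd hh hgh' hL i j k l
      have e3 : ∀ i j k, covD d K i (X j k) l =
          covD d K i (covD d K k (L j)) l - covD d K i (covD d K j (L k)) l := fun i j k =>
        covD_sub i _ _ l
      have e4 : ∀ i j k, ∑ p, curvature d K i k l p * L j p = -∑ p, curvature d K k i l p * L j p := by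
        intro i j k
        rw [curvature_antisymm, ← Finset.sum_neg_distrib]
        exact Finset.sum_congr rfl fun p _ => by rw [Matrix.neg_apply, neg_mul]
      have c := fun a b v => covD_commutator (d := d) (K := K) hd a b v l
      rw [e3, e3, e3]
      have c1 := c i k (L j)
      have c2 := c j i (L k)
      have c3 := c k j (L i)
      rw [e4, e1] at c1 c2 c3
      simp only [mul_sub, Finset.sum_sub_distrib] at c1 c2 c3
      simp only [compatSum] at e2 ⊢
      linear_combination c1 + c2 + c3 + e2
    -- Here `(n - 3) X_{jkl} = a^q C_{jklq}` is differentiated; the terms from recurrence vanish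
    -- cyclically by `h1`, and the connection terms by `sum_connection_cyclic`.
    have h3 : ((Fintype.card ι : A) - 3) *
        (covD d K i (X j k) l + covD d K j (X k i) l + covD d K k (X i j) l) =
        compatSum h C (covD d K · a) i j k l := by
      have e0 : ∀ i (u : ι → A), ((Fintype.card ι : A) - 3) * covD d K i u l =
          covD d K i (fun l => ((Fintype.card ι : A) - 3) * u l) l := by
        intro i u
        have : d i ((Fintype.card ι : A) - 3) = 0 := by
          rw [map_sub, Derivation.map_natCast, zero_sub, neg_eq_zero]
          exact Derivation.map_natCast (d i) 3
        simp only [covD, Derivation.leibniz, this, smul_eq_mul, mul_zero, add_zero, mul_sub,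
          Finset.mul_sum]
        congr 1
        exact Finset.sum_congr rfl fun p _ => by ring
      have e : ∀ i j k, ((Fintype.card ι : A) - 3) * covD d K i (X j k) l =
          (∑ q, raise h (covD d K i a) q * C j k l q) + a i * (∑ q, raise h a q * C j k l q)
          + ∑ p, (K i j p * (∑ q, raise h a q * C p k l q)
            + K i k p * ∑ q, raise h a q * C j p l q) := by
        intro i j k
        rw [e0]
        simp only [hXC, raise_covD hgh hgh' hKg]
        exact hrec.covD_contraction (raise h a) i j k l
      have e' := sum_connection_cyclic hK (T := fun j k => ∑ q, raise h a q * C j k l q)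
        (fun j k => by
          rw [← Finset.sum_neg_distrib]
          exact Finset.sum_congr rfl fun q _ => by rw [hCc.antisymm_left]; ring) i j k
      have h1' := h1 i j k l
      rw [mul_add, mul_add, e, e, e]
      simp only [compatSum]
      linear_combination e' + h1'
    rw [compatSum_add, compatSum_mul_left]
    linear_combination -h3 + ((Fintype.card ι : A) - 3) * h2
  · have hw := recurrent_commutator_four hd K hrec
    have h4 := commutator_compatible hg hh hgh hCc htr
      (Rd := riemannDown d K g) (L := L) (w := fun i j => covD d K i a j - covD d K j a i)
      (fun i j k q => by rw [hC]; unfold metricProd; ring) hL (by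
        intro i j k l m n
        simp only [← hFu]
        rw [← hw]
        -- Without torsion, `∇_i a_j - ∇_j a_i` equals the `d i (a j) - d j (a i)` of the Ricci
        -- identity.
        have : ∑ p, K i j p * a p = ∑ p, K j i p * a p :=
          Finset.sum_congr rfl fun p _ => by rw [hK]
        simp only [covD, this]
        ring) i j k l
    rw [compatSum_add, compatSum_mul_left]
    simp only [compatSum]
    exact h4

end ConformallyRecurrent

/-! ### From the Schouten tensor to the Ricci tensor. -/

section Schouten

variable {A : Type*} [CommRing A] [Algebra ℝ A] {ι : Type*} [Fintype ι] {g h : Matrix ι ι A}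
  {R : ι → ι → ι → ι → A}

/-- The Ricci contraction of a covariant curvature tensor. -/
def ricciForm (h : Matrix ι ι A) (R : ι → ι → ι → ι → A) (k l : ι) : A :=
  -contr h fun m q => R m k l q

/-- The Schouten form of a covariant curvature tensor. -/
def schoutenForm (g h : Matrix ι ι A) (R : ι → ι → ι → ι → A) (k l : ι) : A :=
  algebraMap ℝ A (1 / ((Fintype.card ι : ℝ) - 2)) * ricciForm h R k l
    - algebraMap ℝ A (1 / (2 * ((Fintype.card ι : ℝ) - 1) * ((Fintype.card ι : ℝ) - 2)))
      * contr h (ricciForm h R) * g k l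

theorem ricciForm_symm (hh : ∀ i j, h i j = h j i) (hR : IsCurvatureLike R) (k l : ι) :
    ricciForm h R k l = ricciForm h R l k := by
  unfold ricciForm
  rw [← contr_swap h hh fun m q => R m k l q]
  congr 2
  funext m q
  rw [hR.pair_symm q k l m, hR.antisymm_left, hR.antisymm_right, neg_neg]

theorem schoutenForm_symm (hg : ∀ i j, g i j = g j i) (hh : ∀ i j, h i j = h j i)
    (hR : IsCurvatureLike R) (k l : ι) : schoutenForm g h R k l = schoutenForm g h R l k := by
  rw [schoutenForm, schoutenForm, ricciForm_symm hh hR k l, hg k l]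

variable [DecidableEq ι]

/-- Inverts the definition of the Schouten form; its constants are exactly those making `metricProd`
cancel the Ricci trace in `contr_weyl`. -/
theorem ricciForm_eq (hg : ∀ i j, g i j = g j i) (hgh : h * g = 1) (hn : 5 ≤ Fintype.card ι)
    (k l : ι) : ricciForm h R k l = ((Fintype.card ι : A) - 2) * schoutenForm g h R k l
      + contr h (schoutenForm g h R) * g k l := by
  have hn' : (5 : ℝ) ≤ Fintype.card ι := by exact_mod_cast hn
  set c₁ : A := algebraMap ℝ A (1 / ((Fintype.card ι : ℝ) - 2)) with hc₁
  set c₂ : A := algebraMap ℝ A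
    (1 / (2 * ((Fintype.card ι : ℝ) - 1) * ((Fintype.card ι : ℝ) - 2))) with hc₂
  have e1 : ((Fintype.card ι : A) - 2) * c₁ = 1 := by
    have : (Fintype.card ι : A) - 2 = algebraMap ℝ A ((Fintype.card ι : ℝ) - 2) := by
      rw [map_sub, map_natCast, map_ofNat]
    rw [this, hc₁, ← map_mul, mul_one_div_cancel (by linarith), map_one]
  have e2 : c₁ = (2 * (Fintype.card ι : A) - 2) * c₂ := by
    have : 2 * (Fintype.card ι : A) - 2 = algebraMap ℝ A (2 * (Fintype.card ι : ℝ) - 2) := by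
      rw [map_sub, map_mul, map_natCast, map_ofNat]
    rw [this, hc₁, hc₂, ← map_mul]
    congr 1
    have h1 : (Fintype.card ι : ℝ) - 1 ≠ 0 := by linarith
    have h2 : (Fintype.card ι : ℝ) - 2 ≠ 0 := by linarith
    field_simp
  have e3 : contr h (schoutenForm g h R) =
      c₁ * contr h (ricciForm h R) - Fintype.card ι * (c₂ * contr h (ricciForm h R)) := by
    rw [← contr_metric hg hgh, ← contr_mul_left, ← contr_sub]
    congr 1
    funext i m
    rw [schoutenForm]
    ring
  rw [e3, schoutenForm]
  linear_combination -(ricciForm h R k l) * e1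
    - (contr h (ricciForm h R)) * g k l * e2

theorem contr_weyl (hg : ∀ i j, g i j = g j i) (hh : ∀ i j, h i j = h j i) (hgh : h * g = 1)
    (hn : 5 ≤ Fintype.card ι) (k l : ι) :
    contr h (fun j m => R j k l m + metricProd g (schoutenForm g h R) j k l m) = 0 := by
  rw [contr_add, contr_metricProd hg hh hgh, ← ricciForm_eq hg hgh hn, ricciForm, add_neg_cancel]

/-- Contracting with `g` undoes the raising, so the sum is the first Bianchi identity. Hence
multiples of the metric may be added to a compatible tensor. -/
theorem compatSum_metric (hg : ∀ i j, g i j = g j i) (hgh : h * g = 1)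
    {C : ι → ι → ι → ι → A} (hC : IsCurvatureLike C) (i j k l : ι) :
    compatSum h C g i j k l = 0 := by
  have e : ∀ i j k l, ∑ p, raise h (g i) p * C j k l p = C j k l i :=
    fun i j k l => sum_raise_metric_mul hg hgh i _
  unfold compatSum
  rw [e, e, e]
  linear_combination hC.pair_symm j k l i + hC.pair_symm k i l j + hC.pair_symm i j l k
    + hC.bianchi_right l i j k

variable {d : ι → Derivation ℝ A A} {K : ι → Matrix ι ι A}

/-- The compatibility relations for a recurrent Weyl tensor. -/
theorem IsRecurrent.compatible (hd : ∀ i j f, d i (d j f) = d j (d i f))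
    (hg : ∀ i j, g i j = g j i) (hh : ∀ i j, h i j = h j i) (hgh : h * g = 1) (hgh' : g * h = 1)
    (hn : 5 ≤ Fintype.card ι) (hK : ∀ i j k, K i j k = K j i k)
    (hKg : ∀ i, g.map (d i) = K i * g + g * (K i).transpose)
    (hR : R = riemannDown d K g) {C : ι → ι → ι → ι → A}
    (hC : ∀ j k l m, C j k l m = R j k l m + metricProd g (schoutenForm g h R) j k l m)
    {a : ι → A} (hrec : IsRecurrent d K a C) (i j k l : ι) :
    compatSum h C (fun i j => a i * a j) i j k l = 0 ∧
    compatSum h C (fun i j => covD d K i a j + covD d K j a i + ricciForm h R i j) i j k l = 0 ∧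
    compatSum h C (fun i j => covD d K i a j - covD d K j a i
      + algebraMap ℝ A (((Fintype.card ι : ℝ) - 4) / ((Fintype.card ι : ℝ) - 2))
        * ricciForm h R i j) i j k l = 0 ∧
    ((∀ i j, covD d K i a j - covD d K j a i = 0) →
      compatSum h C (fun i j => covD d K i a j) i j k l = 0 ∧
      compatSum h C (ricciForm h R) i j k l = 0 ∧
      compatSum h R (ricciForm h R) i j k l = 0) := by
  have hRc : IsCurvatureLike R := hR ▸ riemannDown_isCurvatureLike hd hg hK hKg
  set L := schoutenForm g h R with hLdef
  have hL : ∀ i j, L i j = L j i := schoutenForm_symm hg hh hRc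
  have hCc : IsCurvatureLike C := by
    have := hRc.add (metricProd_isCurvatureLike hg hL)
    simpa only [← hC] using this
  have htr : ∀ k l, contr h (fun j m => C j k l m) = 0 := by
    intro k l
    simp only [hC]
    exact contr_weyl hg hh hgh hn k l
  obtain ⟨h1, h2, h3⟩ := hrec.compatSum_eq_zero hd hg hh hgh hgh' hn hK hKg hL
    (hR ▸ hC) htr i j k l
  have h0 := compatSum_metric hg hgh hCc i j k l
  have lin : ∀ (D : ι → ι → ι → ι → A) (x y z : A) (b b' b'' : ι → ι → A),
      compatSum h D (fun i j => x * b i j + y * b' i j + z * b'' i j) i j k l =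
      x * compatSum h D b i j k l + y * compatSum h D b' i j k l
        + z * compatSum h D b'' i j k l := by
    intro D x y z b b' b''
    rw [compatSum_add, compatSum_add, compatSum_mul_left, compatSum_mul_left, compatSum_mul_left]
  have hric : ricciForm h R = fun i j => ((Fintype.card ι : A) - 2) * L i j
      + contr h L * g i j + 0 * g i j := by
    funext i j
    rw [ricciForm_eq hg hgh hn]
    ring
  have hcoef : algebraMap ℝ A (((Fintype.card ι : ℝ) - 4) / ((Fintype.card ι : ℝ) - 2))
      * ((Fintype.card ι : A) - 2) = (Fintype.card ι : A) - 4 := by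
    have hn' : (5 : ℝ) ≤ Fintype.card ι := by exact_mod_cast hn
    have e2 : (Fintype.card ι : A) - 2 = algebraMap ℝ A ((Fintype.card ι : ℝ) - 2) := by
      rw [map_sub, map_natCast, map_ofNat]
    have e4 : (Fintype.card ι : A) - 4 = algebraMap ℝ A ((Fintype.card ι : ℝ) - 4) := by
      rw [map_sub, map_natCast, map_ofNat]
    rw [e2, e4, ← map_mul, div_mul_cancel₀ _ (by linarith)]
  refine ⟨h1, ?_, ?_, ?_⟩
  -- Twice `h2` minus `h3` has Schouten coefficient `2 (n - 3) - (n - 4) = n - 2`; the multiple of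
  -- `g` completes it to the Ricci form.
  · have := lin C 2 (-1) (contr h L) (fun i j => covD d K i a j + ((Fintype.card ι : A) - 3) * L i j)
      (fun i j => covD d K i a j - covD d K j a i + ((Fintype.card ι : A) - 4) * L i j) g
    rw [h0, h2, h3] at this
    simp only [mul_zero, add_zero] at this
    rw [← this, hric]
    congr 1
    funext i j
    ring
  · have := lin C 1 (algebraMap ℝ A (((Fintype.card ι : ℝ) - 4) / ((Fintype.card ι : ℝ) - 2))
      * contr h L) 0
      (fun i j => covD d K i a j - covD d K j a i + ((Fintype.card ι : A) - 4) * L i j) g g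
    rw [h0, h3] at this
    simp only [mul_zero, add_zero] at this
    rw [← this, hric]
    congr 1
    funext i j
    linear_combination L i j * hcoef
  · intro hcl
    simp only [hcl, zero_add] at h3
    rw [compatSum_mul_left] at h3
    -- For closed `a` only `(n - 4) L` is left in `h3`.
    have hLc : compatSum h C L i j k l = 0 :=
      eq_zero_of_natCast_sub_mul_eq_zero (n := Fintype.card ι) (k := 4) (by omega)
        (by push_cast; exact h3)
    refine ⟨?_, ?_, ?_⟩
    · rw [compatSum_add, compatSum_mul_left, hLc] at h2
      simpa using h2
    · rw [hric, lin C _ _ _ L g g, hLc, h0]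
      ring
    · have hRC : R = fun j k l m => C j k l m - metricProd g L j k l m := by
        funext j k l m
        rw [hC]
        ring
      rw [hric, lin R _ _ _ L g g, compatSum_metric hg hgh hRc, hRC, compatSum_sub_tensor, hLc,
        compatSum_metricProd hh hgh' hL]
      ring

end Schouten

/-! ### Smooth functions on an open set as a differential ring. -/

section SmoothRing

variable {n : ℕ}

theorem pd_congr_of_isOpen {U : Set (EuclideanSpace ℝ (Fin n))} (hU : IsOpen U)
    {F F' : EuclideanSpace ℝ (Fin n) → ℝ} (h : Set.EqOn F F' U) (i : Fin n) :
    Set.EqOn (pd i F) (pd i F') U := by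
  intro x hx
  unfold pd
  rw [(h.eventuallyEq_of_mem (hU.mem_nhds hx)).fderiv_eq]

theorem contDiffOn_pd {U : Set (EuclideanSpace ℝ (Fin n))} (hU : IsOpen U)
    {F : EuclideanSpace ℝ (Fin n) → ℝ} (hF : ContDiffOn ℝ ∞ F U) (i : Fin n) :
    ContDiffOn ℝ ∞ (pd i F) U :=
  (hF.fderiv_of_isOpen hU (m := ∞) (by simp)).clm_apply contDiffOn_const

theorem pd_comm {U : Set (EuclideanSpace ℝ (Fin n))} (hU : IsOpen U)
    {F : EuclideanSpace ℝ (Fin n) → ℝ} (hF : ContDiffOn ℝ ∞ F U) (i j : Fin n)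
    {x : EuclideanSpace ℝ (Fin n)} (hx : x ∈ U) : pd i (pd j F) x = pd j (pd i F) x := by
  have h1 : ContDiffAt ℝ ∞ F x := hF.contDiffAt (hU.mem_nhds hx)
  have h2 : DifferentiableAt ℝ (fderiv ℝ F) x :=
    (h1.fderiv_right (m := 1) (WithTop.coe_le_coe.2 (le_top : (1 + 1 : ℕ∞) ≤ ⊤))).differentiableAt (by simp)
  have key : ∀ k l : Fin n, pd k (pd l F) x =
      fderiv ℝ (fderiv ℝ F) x (EuclideanSpace.single k 1) (EuclideanSpace.single l 1) := by
    intro k l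
    change fderiv ℝ (fun y => fderiv ℝ F y (EuclideanSpace.single l 1)) x _ = _
    rw [fderiv_clm_apply h2 (differentiableAt_const _)]
    simp
  rw [key, key]
  exact (h1.isSymmSndFDerivAt (by
    rw [minSmoothness_of_isRCLikeNormedField]
    exact ENat.LEInfty.out)).eq _ _

/-- The `ℝ`-algebra of smooth functions on a subset `U` of `ℝⁿ`. -/
def smoothRing (U : Set (EuclideanSpace ℝ (Fin n))) : Subalgebra ℝ (U → ℝ) where
  carrier := {f | ∃ F : EuclideanSpace ℝ (Fin n) → ℝ, ContDiffOn ℝ ∞ F U ∧ ∀ x : U, F x = f x}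
  mul_mem' := by
    rintro f f' ⟨F, hF, h⟩ ⟨F', hF', h'⟩
    exact ⟨fun x => F x * F' x, hF.mul hF', fun x => by simp [h, h']⟩
  add_mem' := by
    rintro f f' ⟨F, hF, h⟩ ⟨F', hF', h'⟩
    exact ⟨fun x => F x + F' x, hF.add hF', fun x => by simp [h, h']⟩
  algebraMap_mem' := fun r => ⟨fun _ => r, contDiffOn_const, fun _ => rfl⟩

variable {U : Set (EuclideanSpace ℝ (Fin n))}

/-- The element of `smoothRing U` given by a function that is smooth on `U`. -/
def smoothRing.of (F : EuclideanSpace ℝ (Fin n) → ℝ) (hF : ContDiffOn ℝ ∞ F U) : smoothRing U :=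
  ⟨fun x => F x, F, hF, fun _ => rfl⟩

@[simp] theorem smoothRing.of_apply (F : EuclideanSpace ℝ (Fin n) → ℝ)
    (hF : ContDiffOn ℝ ∞ F U) (x : U) : (smoothRing.of F hF : U → ℝ) x = F x := rfl

/-- An extension of an element of `smoothRing U` to all of `ℝⁿ`. -/
def smoothRing.rep (f : smoothRing U) : EuclideanSpace ℝ (Fin n) → ℝ := f.2.choose

theorem smoothRing.contDiffOn_rep (f : smoothRing U) : ContDiffOn ℝ ∞ (smoothRing.rep f) U :=
  f.2.choose_spec.1

theorem smoothRing.rep_apply (f : smoothRing U) (x : U) : (smoothRing.rep f) x = (f : U → ℝ) x :=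
  f.2.choose_spec.2 x

/-- The chosen extension is arbitrary off `U`, but `U` is open, so derivatives at points of `U` do
not depend on it. -/
theorem smoothRing.pd_rep (hU : IsOpen U) (i : Fin n) (f : smoothRing U)
    {F : EuclideanSpace ℝ (Fin n) → ℝ} (h : ∀ x : U, (f : U → ℝ) x = F x) (x : U) :
    pd i (smoothRing.rep f) x = pd i F x :=
  pd_congr_of_isOpen hU (fun y hy => (smoothRing.rep_apply f ⟨y, hy⟩).trans (h ⟨y, hy⟩)) i x.2

/-- The coordinate partial derivative, as a derivation of the ring of smooth functions. -/
def smoothRing.deriv (hU : IsOpen U) (i : Fin n) : Derivation ℝ (smoothRing U) (smoothRing U) :=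
  Derivation.mk'
    { toFun := fun f => smoothRing.of (pd i (smoothRing.rep f)) (contDiffOn_pd hU (smoothRing.contDiffOn_rep f) i)
      map_add' := by
        intro f f'
        ext x
        have hd := fun f : smoothRing U =>
          ((smoothRing.contDiffOn_rep f).contDiffAt (hU.mem_nhds x.2)).differentiableAt (by simp)
        simp only [smoothRing.of_apply, AddMemClass.coe_add, Pi.add_apply]
        rw [smoothRing.pd_rep hU i (f + f') (F := fun y => (smoothRing.rep f) y + (smoothRing.rep f') y)
          (fun x => by simp [smoothRing.rep_apply])]
        simp only [pd]
        rw [fderiv_fun_add (hd f) (hd f')]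
        rfl
      map_smul' := by
        intro c f
        ext x
        have hd := fun f : smoothRing U =>
          ((smoothRing.contDiffOn_rep f).contDiffAt (hU.mem_nhds x.2)).differentiableAt (by simp)
        simp only [smoothRing.of_apply, SetLike.val_smul, Pi.smul_apply, RingHom.id_apply]
        rw [smoothRing.pd_rep hU i (c • f) (F := fun y => c • (smoothRing.rep f) y)
          (fun x => by simp [smoothRing.rep_apply])]
        simp only [pd]
        rw [fderiv_fun_const_smul (hd f)]
        rfl }
    (by
      intro f f'
      ext x
      have hd := fun f : smoothRing U =>
        ((smoothRing.contDiffOn_rep f).contDiffAt (hU.mem_nhds x.2)).differentiableAt (by simp)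
      simp only [LinearMap.coe_mk, AddHom.coe_mk, smoothRing.of_apply, AddMemClass.coe_add,
        Pi.add_apply, smul_eq_mul, MulMemClass.coe_mul, Pi.mul_apply]
      rw [smoothRing.pd_rep hU i (f * f') (F := fun y => (smoothRing.rep f) y * (smoothRing.rep f') y)
        (fun x => by simp [smoothRing.rep_apply])]
      simp only [pd]
      rw [fderiv_fun_mul (hd f) (hd f')]
      simp [smoothRing.rep_apply])

theorem smoothRing.deriv_of (hU : IsOpen U) (i : Fin n) (F : EuclideanSpace ℝ (Fin n) → ℝ)
    (hF : ContDiffOn ℝ ∞ F U) :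
    smoothRing.deriv hU i (smoothRing.of F hF) =
      smoothRing.of (pd i F) (contDiffOn_pd hU hF i) := by
  ext x
  exact smoothRing.pd_rep hU i (smoothRing.of F hF) (fun _ => rfl) x

theorem smoothRing.deriv_comm (hU : IsOpen U) (i j : Fin n) (f : smoothRing U) :
    smoothRing.deriv hU i (smoothRing.deriv hU j f) =
      smoothRing.deriv hU j (smoothRing.deriv hU i f) := by
  have : f = smoothRing.of (smoothRing.rep f) (smoothRing.contDiffOn_rep f) := by
    ext x
    exact (smoothRing.rep_apply f x).symm
  rw [this]
  simp only [smoothRing.deriv_of]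
  ext x
  exact pd_comm hU (smoothRing.contDiffOn_rep f) i j x.2

end SmoothRing

/-! ### Smoothness and nondegeneracy of components in a chart. -/

section Charts

variable {n : ℕ} {M : Type*} [TopologicalSpace M] [ChartedSpace (EuclideanSpace ℝ (Fin n)) M]

attribute [local instance 2000] chartedSpaceSelf

variable [IsManifold (𝓡 n) ∞ M]

/-- A coordinate field is the image of a constant vector field under the differential of the smooth
inverse chart. -/
theorem contMDiffOn_coordVec {e : OpenPartialHomeomorph M (EuclideanSpace ℝ (Fin n))}
    (he : e ∈ IsManifold.maximalAtlas (𝓡 n) ∞ M) (i : Fin n) :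
    ContMDiffOn (𝓡 n) ((𝓡 n).prod 𝓘(ℝ, EuclideanSpace ℝ (Fin n))) ∞
      (fun y => (Bundle.TotalSpace.mk' (EuclideanSpace ℝ (Fin n)) (e.symm y) (coordVec e i y) :
        TangentBundle (𝓡 n) M)) e.target := by
  have : IsManifold (𝓡 n) 1 M := IsManifold.of_le (n := ∞) (by simp)
  intro y hy
  apply ContMDiffAt.contMDiffWithinAt
  have h1 := contMDiffAt_symm_of_mem_maximalAtlas he hy
  have hv : ContMDiffAt (𝓡 n) ((𝓡 n).prod 𝓘(ℝ, EuclideanSpace ℝ (Fin n))) ∞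
      (fun z => (Bundle.TotalSpace.mk' (EuclideanSpace ℝ (Fin n)) z
        (EuclideanSpace.single i (1 : ℝ) : EuclideanSpace ℝ (Fin n)) :
        TangentBundle (𝓡 n) (EuclideanSpace ℝ (Fin n)))) y := by
    exact contMDiffAt_vectorSpace_iff_contDiffAt.2 contDiffAt_const
  exact ContMDiffAt.clm_apply_of_inCoordinates
    (ContMDiffAt.mfderiv_const h1 (by simp)) hv h1

theorem contDiffOn_comp_metric (g : PseudoRiemannianMetric n M)
    {e : OpenPartialHomeomorph M (EuclideanSpace ℝ (Fin n))}
    (he : e ∈ IsManifold.maximalAtlas (𝓡 n) ∞ M) (i j : Fin n) :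
    ContDiffOn ℝ ∞ (fun y => g.comp e y i j) e.target := by
  have h1 := contMDiffOn_symm_of_mem_maximalAtlas he
  have h2 := g.contMDiff.comp_contMDiffOn h1
  have h3 := ContMDiffOn.clm_bundle_apply₂ (E₃ := fun _ : M => ℝ) (F₃ := ℝ) h2
    (contMDiffOn_coordVec he i) (contMDiffOn_coordVec he j)
  rw [← contMDiffOn_iff_contDiffOn]
  intro y hy
  exact ((Bundle.contMDiffWithinAt_totalSpace).1 (h3 y hy)).2

theorem contDiffOn_comp_covector (a : CovectorField n M)
    {e : OpenPartialHomeomorph M (EuclideanSpace ℝ (Fin n))}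
    (he : e ∈ IsManifold.maximalAtlas (𝓡 n) ∞ M) (i : Fin n) :
    ContDiffOn ℝ ∞ (fun y => a.comp e y i) e.target := by
  have h1 := contMDiffOn_symm_of_mem_maximalAtlas he
  have h2 := a.contMDiff.comp_contMDiffOn h1
  have h3 := ContMDiffOn.clm_bundle_apply (E₂ := fun _ : M => ℝ) (F₂ := ℝ) h2
    (contMDiffOn_coordVec he i)
  rw [← contMDiffOn_iff_contDiffOn]
  intro y hy
  exact ((Bundle.contMDiffWithinAt_totalSpace).1 (h3 y hy)).2

theorem comp_metric_symm (g : PseudoRiemannianMetric n M)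
    (e : OpenPartialHomeomorph M (EuclideanSpace ℝ (Fin n))) (y : EuclideanSpace ℝ (Fin n))
    (i j : Fin n) : g.comp e y i j = g.comp e y j i :=
  g.symm _ _ _

/-- A null vector of the component matrix maps to a tangent vector orthogonal to the image of the
chart differential. That differential is bijective, so nondegeneracy forces the vector to vanish. -/
theorem isUnit_det_comp_metric (g : PseudoRiemannianMetric n M)
    {e : OpenPartialHomeomorph M (EuclideanSpace ℝ (Fin n))}
    (he : e ∈ IsManifold.maximalAtlas (𝓡 n) ∞ M) {y : EuclideanSpace ℝ (Fin n)}
    (hy : y ∈ e.target) : IsUnit (g.comp e y).det := by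
  have hmd : e.symm.MDifferentiable (𝓡 n) (𝓡 n) :=
    ⟨(contMDiffOn_symm_of_mem_maximalAtlas he).mdifferentiableOn (by simp),
      (contMDiffOn_of_mem_maximalAtlas he).mdifferentiableOn (by simp)⟩
  have hinj := hmd.mfderiv_injective (x := y) hy
  have hsurj := hmd.mfderiv_surjective (x := y) hy
  set A : EuclideanSpace ℝ (Fin n) →L[ℝ] TangentSpace (𝓡 n) (e.symm y) :=
    mfderiv (𝓡 n) (𝓡 n) e.symm y with hA
  rw [isUnit_iff_ne_zero]
  intro hdet
  obtain ⟨v, hv0, hv⟩ := Matrix.exists_vecMul_eq_zero_iff.2 hdet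
  have hsum : ∀ w : EuclideanSpace ℝ (Fin n), A w = ∑ i, w i • coordVec e i y := by
    intro w
    have : w = ∑ i, w i • (EuclideanSpace.single i (1 : ℝ) : EuclideanSpace ℝ (Fin n)) := by
      ext k
      simp [Finset.sum_apply, Pi.single_apply]
    conv_lhs => rw [this]
    rw [map_sum]
    simp only [map_smul]
    rfl
  have hz : A (WithLp.toLp 2 v) = 0 := by
    apply g.nondegenerate
    intro w
    obtain ⟨u, rfl⟩ := hsurj w
    change g.val _ (A _) (A u) = 0
    rw [hsum, hsum u]
    simp only [map_sum, map_smul, sum_apply, smul_apply,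
      smul_eq_mul]
    apply Finset.sum_eq_zero
    intro j _
    have := congrFun hv j
    simp only [Matrix.vecMul, dotProduct, Pi.zero_apply] at this
    have h2 : ∑ i, v i * g.val (e.symm y) (coordVec e i y) (coordVec e j y) = 0 := this
    simp [h2]
  apply hv0
  have : (WithLp.toLp 2 v : EuclideanSpace ℝ (Fin n)) = 0 := hinj (hz.trans (map_zero A).symm)
  simpa using this

end Charts

/-! ### The coordinate tensors in terms of the algebraic ones. -/

section Pointwise

variable {n : ℕ} {g : EuclideanSpace ℝ (Fin n) → Matrix (Fin n) (Fin n) ℝ}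
  {y : EuclideanSpace ℝ (Fin n)}

/-- Components `R_{jklm}` of the covariant Riemann tensor. -/
def riemannLower (g : EuclideanSpace ℝ (Fin n) → Matrix (Fin n) (Fin n) ℝ)
    (y : EuclideanSpace ℝ (Fin n)) (j k l m : Fin n) : ℝ :=
  ∑ p, riemann g y j k l p * g y p m

theorem raise_sum_mul_metric (hg : ∀ i j, g y i j = g y j i) (hdet : IsUnit (g y).det)
    (T : Fin n → ℝ) (m : Fin n) : raise (g y)⁻¹ (fun q => ∑ p, T p * g y p q) m = T m := by
  rw [← raise_lower (Matrix.nonsing_inv_mul _ hdet) T m]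
  simp only [hg]

theorem ricci_eq_ricciForm (hg : ∀ i j, g y i j = g y j i) (hdet : IsUnit (g y).det) :
    ricci g y = ricciForm (g y)⁻¹ (riemannLower g y) := by
  funext k l
  unfold ricci ricciForm
  congr 1
  exact Finset.sum_congr rfl fun m _ => (raise_sum_mul_metric hg hdet (riemann g y m k l) m).symm

theorem scalarCurv_eq_contr : scalarCurv g y = contr (g y)⁻¹ (ricci g y) := rfl

theorem weylDown_eq (hg : ∀ i j, g y i j = g y j i) (hdet : IsUnit (g y).det) (j k l m : Fin n) :
    weylDown g y j k l m = riemannLower g y j k l m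
      + metricProd (g y) (schoutenForm (g y) (g y)⁻¹ (riemannLower g y)) j k l m := by
  have hup : ∀ j, ∑ p, ricciUp g y j p * g y p m = ricci g y j m := by
    intro j
    have := Matrix.nonsing_inv_mul _ hdet
    simp only [ricciUp, Finset.sum_mul, mul_assoc]
    rw [Finset.sum_comm]
    simp only [← Finset.mul_sum, sum_inv_mul this]
    simp
  have hδ : ∀ j (c : ℝ), ∑ p, (if j = p then 1 else 0) * c * g y p m = c * g y j m := by
    intro j c
    simp
  have hs : weylDown g y j k l m = riemannLower g y j k l m
      + 1 / ((n : ℝ) - 2) * (∑ p, (if j = p then 1 else 0) * ricci g y k l * g y p m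
        - ∑ p, (if k = p then 1 else 0) * ricci g y j l * g y p m
        + (∑ p, ricciUp g y j p * g y p m) * g y k l - (∑ p, ricciUp g y k p * g y p m) * g y j l)
      - scalarCurv g y / (((n : ℝ) - 1) * ((n : ℝ) - 2))
        * (∑ p, (if j = p then 1 else 0) * g y k l * g y p m
          - ∑ p, (if k = p then 1 else 0) * g y j l * g y p m) := by
    simp only [weylDown, riemannLower, weyl, Finset.mul_sum, Finset.sum_mul,
      ← Finset.sum_add_distrib, ← Finset.sum_sub_distrib]
    exact Finset.sum_congr rfl fun p _ => by ring
  rw [hs, hδ, hδ, hδ, hδ, hup, hup, metricProd]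
  simp only [schoutenForm, ← ricci_eq_ricciForm hg hdet, ← scalarCurv_eq_contr, Fintype.card_fin,
    Algebra.algebraMap_self, RingHom.id_apply]
  -- The metric part of the Schouten form enters `metricProd` twice, whence the `2` in its
  -- denominator.
  have e : scalarCurv g y / (((n : ℝ) - 1) * ((n : ℝ) - 2)) =
      2 * (1 / (2 * ((n : ℝ) - 1) * ((n : ℝ) - 2)) * scalarCurv g y) := by
    rw [mul_assoc 2 _ ((n : ℝ) - 2), div_eq_mul_inv, one_div, mul_inv 2]
    ring
  rw [e]
  ring

/-- The two notions differ only in whether `b` or the curvature carries the raised index. -/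
theorem isCompatible_of_compatSum {K C : Fin n → Fin n → Fin n → Fin n → ℝ}
    {h : Matrix (Fin n) (Fin n) ℝ} (hh : ∀ i j, h i j = h j i)
    (hK : ∀ j k l m, K j k l m = raise h (C j k l) m) {b : Fin n → Fin n → ℝ}
    (hb : ∀ i j k l, compatSum h C b i j k l = 0) : IsCompatible K b := by
  intro i j k l
  rw [← hb i j k l, compatSum, sum_raise_mul_comm hh, sum_raise_mul_comm hh (b j),
    sum_raise_mul_comm hh (b k), ← Finset.sum_add_distrib, ← Finset.sum_add_distrib]
  refine Finset.sum_congr rfl fun m _ => ?_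
  rw [hK, hK, hK]
  ring

end Pointwise

/-! ### Naturality under algebra homomorphisms, for evaluation at a point. -/

section Map

variable {A B : Type*} [CommRing A] [Algebra ℝ A] [CommRing B] [Algebra ℝ B] {ι : Type*}
  (φ : A →ₐ[ℝ] B) (g h : Matrix ι ι A)

theorem map_metricProd (L : ι → ι → A) (j k l m : ι) :
    φ (metricProd g L j k l m) = metricProd (g.map φ) (fun i j => φ (L i j)) j k l m := by
  simp [metricProd]

variable [Fintype ι]

theorem map_contr (T : ι → ι → A) :
    φ (contr h T) = contr (h.map φ) (fun i j => φ (T i j)) := by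
  simp [contr]

theorem map_ricciForm (R : ι → ι → ι → ι → A) (k l : ι) :
    φ (ricciForm h R k l) = ricciForm (h.map φ) (fun i j k l => φ (R i j k l)) k l := by
  simp [ricciForm, map_contr]

theorem map_schoutenForm (R : ι → ι → ι → ι → A) (k l : ι) :
    φ (schoutenForm g h R k l) =
      schoutenForm (g.map φ) (h.map φ) (fun i j k l => φ (R i j k l)) k l := by
  simp only [schoutenForm, map_sub, map_mul, AlgHom.commutes, map_ricciForm, map_contr,
    Matrix.map_apply]

theorem map_compatSum (C : ι → ι → ι → ι → A) (b : ι → ι → A) (i j k l : ι) :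
    φ (compatSum h C b i j k l) =
      compatSum (h.map φ) (fun i j k l => φ (C i j k l)) (fun i j => φ (b i j)) i j k l := by
  simp [compatSum, raise]

end Map

/-! ### The theorem in a coordinate domain. -/

section Coordinates

variable {n : ℕ} {U : Set (EuclideanSpace ℝ (Fin n))}
  {g : EuclideanSpace ℝ (Fin n) → Matrix (Fin n) (Fin n) ℝ}

theorem contDiffOn_det (hg : ∀ i j, ContDiffOn ℝ ∞ (fun y => g y i j) U) :
    ContDiffOn ℝ ∞ (fun y => (g y).det) U := by
  simp only [Matrix.det_apply]
  exact ContDiffOn.sum fun σ _ => (contDiffOn_prod fun i _ => hg _ _).const_smul _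

theorem contDiffOn_inv_apply (hg : ∀ i j, ContDiffOn ℝ ∞ (fun y => g y i j) U)
    (hdet : ∀ y ∈ U, IsUnit (g y).det) (i j : Fin n) :
    ContDiffOn ℝ ∞ (fun y => (g y)⁻¹ i j) U := by
  have hadj : ContDiffOn ℝ ∞ (fun y => (g y).adjugate i j) U := by
    simp only [Matrix.adjugate_apply]
    refine contDiffOn_det fun a b => ?_
    simp only [Matrix.updateRow_apply]
    split_ifs
    · exact contDiffOn_const
    · exact hg a b
  simp only [Matrix.inv_def, Ring.inverse_eq_inv', Matrix.smul_apply, smul_eq_mul]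
  exact ((contDiffOn_det hg).inv fun y hy => (hdet y hy).ne_zero).mul hadj

theorem contDiffOn_christoffel (hU : IsOpen U) (hg : ∀ i j, ContDiffOn ℝ ∞ (fun y => g y i j) U)
    (hdet : ∀ y ∈ U, IsUnit (g y).det) (i j k : Fin n) :
    ContDiffOn ℝ ∞ (christoffel g i j k) U :=
  contDiffOn_const.mul (ContDiffOn.sum fun l _ => (contDiffOn_inv_apply hg hdet k l).mul
    (((contDiffOn_pd hU (hg j l) i).add (contDiffOn_pd hU (hg i l) j)).sub
      (contDiffOn_pd hU (hg i j) l)))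

theorem christoffel_symm (hg : ∀ y i j, g y i j = g y j i) (i j k : Fin n)
    (y : EuclideanSpace ℝ (Fin n)) : christoffel g i j k y = christoffel g j i k y := by
  unfold christoffel
  congr 1
  refine Finset.sum_congr rfl fun l _ => ?_
  simp only [fun z => hg z j i]
  ring

/-- Metric compatibility: in the sum of the lowered Christoffel symbols for `i j k` and `i k j`, all
but the derivative in direction `i` cancels. -/
theorem pd_metric (hg : ∀ y i j, g y i j = g y j i) {y : EuclideanSpace ℝ (Fin n)}
    (hdet : IsUnit (g y).det) (i j k : Fin n) :
    pd i (fun z => g z j k) y =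
      ∑ p, christoffel g i j p y * g y p k + ∑ p, g y j p * christoffel g i k p y := by
  have key : ∀ i j k, ∑ p, christoffel g i j p y * g y p k = (1 / 2) *
      (pd i (fun z => g z j k) y + pd j (fun z => g z i k) y - pd k (fun z => g z i j) y) := by
    intro i j k
    rw [← sum_raise_mul_metric (Matrix.mul_nonsing_inv _ hdet) (fun l =>
      pd i (fun z => g z j l) y + pd j (fun z => g z i l) y - pd l (fun z => g z i j) y) k,
      Finset.mul_sum]
    refine Finset.sum_congr rfl fun p _ => ?_
    rw [christoffel, raise, hg y p k]
    ring
  have e : ∑ p, g y j p * christoffel g i k p y = ∑ p, christoffel g i k p y * g y p j :=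
    Finset.sum_congr rfl fun p _ => by rw [hg y j p, mul_comm]
  rw [e, key, key]
  simp only [fun z => hg z k j]
  ring

variable (U) in
/-- Evaluation of smooth functions at a point. -/
def smoothRing.eval (x : U) : smoothRing U →ₐ[ℝ] ℝ :=
  (Pi.evalAlgHom ℝ (fun _ : U => ℝ) x).comp (smoothRing U).val

theorem smoothRing.eval_ext {f f' : smoothRing U}
    (h : ∀ x, smoothRing.eval U x f = smoothRing.eval U x f') : f = f' :=
  Subtype.ext (funext h)

theorem smoothRing.eval_deriv (hU : IsOpen U) (i : Fin n) {f : smoothRing U}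
    {F : EuclideanSpace ℝ (Fin n) → ℝ} (h : ∀ x : U, smoothRing.eval U x f = F x) (x : U) :
    smoothRing.eval U x (smoothRing.deriv hU i f) = pd i F x :=
  smoothRing.pd_rep hU i f h x

/-- The compatibility relations in a coordinate domain. -/
theorem isCompatible_of_recurrent (hn : 5 ≤ n) (hU : IsOpen U)
    (hgs : ∀ i j, ContDiffOn ℝ ∞ (fun y => g y i j) U) (hg : ∀ y i j, g y i j = g y j i)
    (hdet : ∀ y ∈ U, IsUnit (g y).det) {a : EuclideanSpace ℝ (Fin n) → Fin n → ℝ}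
    (ha : ∀ i, ContDiffOn ℝ ∞ (fun y => a y i) U)
    (hrec : ∀ y ∈ U, ∀ i j k l m,
      covDeriv4 g (weylDown g) y i j k l m = a y i * weylDown g y j k l m)
    {y : EuclideanSpace ℝ (Fin n)} (hy : y ∈ U) :
    IsCompatible (weyl g y) (fun i j => a y i * a y j) ∧
    IsCompatible (weyl g y) (fun i j => covDeriv1 g a y i j + covDeriv1 g a y j i + ricci g y i j) ∧
    IsCompatible (weyl g y) (fun i j => covDeriv1 g a y i j - covDeriv1 g a y j i
      + ((n : ℝ) - 4) / ((n : ℝ) - 2) * ricci g y i j) ∧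
    ((∀ z ∈ U, ∀ i j, covDeriv1 g a z i j - covDeriv1 g a z j i = 0) →
      IsCompatible (weyl g y) (fun i j => covDeriv1 g a y i j) ∧
      IsCompatible (weyl g y) (fun i j => ricci g y i j) ∧
      IsCompatible (riemann g y) (fun i j => ricci g y i j)) := by
  set d := smoothRing.deriv hU with hd
  set G : Matrix (Fin n) (Fin n) (smoothRing U) :=
    Matrix.of fun i j => smoothRing.of (fun y => g y i j) (hgs i j) with hG
  set H : Matrix (Fin n) (Fin n) (smoothRing U) :=
    Matrix.of fun i j => smoothRing.of (fun y => (g y)⁻¹ i j) (contDiffOn_inv_apply hgs hdet i j)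
    with hH
  set K : Fin n → Matrix (Fin n) (Fin n) (smoothRing U) := fun i =>
    Matrix.of fun j k => smoothRing.of (christoffel g i j k) (contDiffOn_christoffel hU hgs hdet i j k)
    with hK
  set α : Fin n → smoothRing U := fun i => smoothRing.of (fun y => a y i) (ha i) with hα
  set R := riemannDown d K G with hR
  set C : Fin n → Fin n → Fin n → Fin n → smoothRing U :=
    fun j k l m => R j k l m + metricProd G (schoutenForm G H R) j k l m with hC
  have evG : ∀ x : U, G.map (smoothRing.eval U x) = g x := fun x => rfl
  have evH : ∀ x : U, H.map (smoothRing.eval U x) = (g x)⁻¹ := fun x => rfl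
  have evK : ∀ (x : U) i j k, smoothRing.eval U x (K i j k) = christoffel g i j k x :=
    fun _ _ _ _ => rfl
  have evα : ∀ (x : U) i, smoothRing.eval U x (α i) = a x i := fun _ _ => rfl
  have evR : ∀ (x : U) j k l m, smoothRing.eval U x (R j k l m) = riemannLower g x j k l m := by
    intro x j k l m
    simp only [hR, riemannDown, curvature, Matrix.mul_apply, Matrix.add_apply, Matrix.sub_apply,
      Matrix.map_apply, map_sum, map_mul, map_add, map_sub, riemannLower, riemann, evK,
      smoothRing.eval_deriv hU _ (fun x => evK x _ _ _), hd]
    refine Finset.sum_congr rfl fun p _ => ?_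
    rw [Finset.sum_sub_distrib, ← evG x, Matrix.map_apply]
    ring
  have evC : ∀ (x : U) j k l m, smoothRing.eval U x (C j k l m) = weylDown g x j k l m := by
    intro x j k l m
    rw [weylDown_eq (hg x) (hdet x x.2)]
    simp only [hC, map_add, map_metricProd, map_schoutenForm, evR, evG, evH]
  have evN : ∀ (x : U) i j, smoothRing.eval U x (covD d K i α j) = covDeriv1 g a x i j := by
    intro x i j
    simp only [covD, covDeriv1, map_sub, map_sum, map_mul, evK, evα, hd,
      smoothRing.eval_deriv hU i (F := fun z => a z j) (fun x => evα x j)]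
  have evRic : ∀ (x : U) i j, smoothRing.eval U x (ricciForm H R i j) = ricci g x i j := by
    intro x i j
    rw [ricci_eq_ricciForm (hg x) (hdet x x.2)]
    simp only [map_ricciForm, evR, evH]
  have hsymH : ∀ y i j, (g y)⁻¹ i j = (g y)⁻¹ j i := by
    intro y i j
    have : (g y).transpose = g y := by ext i j; exact hg y j i
    conv_rhs => rw [← this, ← Matrix.transpose_nonsing_inv]
    rfl
  have hrecA : IsRecurrent d K α C := by
    intro i j k l m
    refine smoothRing.eval_ext fun x => ?_
    have := hrec x x.2 i j k l m
    simp only [hd, map_add, map_sum, map_mul, evK, evα, evC,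
      smoothRing.eval_deriv hU i (F := fun z => weylDown g z j k l m)
        (fun x => evC x j k l m)]
    rw [covDeriv4] at this
    linear_combination this
  have hgh : ∀ x : U, (g x)⁻¹ * g x = 1 := fun x => Matrix.nonsing_inv_mul _ (hdet x x.2)
  have hgh' : ∀ x : U, g x * (g x)⁻¹ = 1 := fun x => Matrix.mul_nonsing_inv _ (hdet x x.2)
  have key := fun i j k l => hrecA.compatible (d := d) (R := R) (g := G) (h := H)
    (smoothRing.deriv_comm hU)
    (fun i j => smoothRing.eval_ext fun x => hg x i j)
    (fun i j => smoothRing.eval_ext fun x => hsymH x i j)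
    (by
      refine Matrix.ext fun i j => smoothRing.eval_ext fun x => ?_
      have := congrFun (congrFun (hgh x) i) j
      rw [Matrix.mul_apply] at this ⊢
      rw [map_sum]
      refine (Finset.sum_congr rfl fun p _ => map_mul _ _ _).trans (this.trans ?_)
      simp only [Matrix.one_apply]
      split_ifs <;> simp)
    (by
      refine Matrix.ext fun i j => smoothRing.eval_ext fun x => ?_
      have := congrFun (congrFun (hgh' x) i) j
      rw [Matrix.mul_apply] at this ⊢
      rw [map_sum]
      refine (Finset.sum_congr rfl fun p _ => map_mul _ _ _).trans (this.trans ?_)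
      simp only [Matrix.one_apply]
      split_ifs <;> simp)
    (by simpa using hn)
    (fun i j k => smoothRing.eval_ext fun x => christoffel_symm hg i j k x)
    (by
      intro i
      refine Matrix.ext fun j k => smoothRing.eval_ext fun x => ?_
      simp only [Matrix.map_apply, Matrix.add_apply, Matrix.mul_apply, Matrix.transpose_apply,
        map_add, map_sum, map_mul, evK, hd,
        smoothRing.eval_deriv hU i (f := G j k) (F := fun z => g z j k) (fun x => rfl)]
      exact pd_metric hg (hdet x x.2) i j k)
    hR (fun _ _ _ _ => rfl) i j k l
  have evC' : ∀ x : U, (fun i j k l => smoothRing.eval U x (C i j k l)) = weylDown g x :=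
    fun x => by funext i j k l; exact evC x i j k l
  have evR' : ∀ x : U, (fun i j k l => smoothRing.eval U x (R i j k l)) = riemannLower g x :=
    fun x => by funext i j k l; exact evR x i j k l
  -- An identity in the ring is evaluated at `y`, and the last index of the lowered Weyl tensor is
  -- raised again.
  have compW : ∀ (b : Fin n → Fin n → smoothRing U) (b' : Fin n → Fin n → ℝ),
      (∀ i j, smoothRing.eval U ⟨y, hy⟩ (b i j) = b' i j) →
      (∀ i j k l, compatSum H C b i j k l = 0) → IsCompatible (weyl g y) b' := by
    intro b b' hb hz
    refine isCompatible_of_compatSum (h := (g y)⁻¹) (C := weylDown g y) (hsymH y)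
      (fun j k l m => (raise_sum_mul_metric (hg y) (hdet y hy) (weyl g y j k l) m).symm) ?_
    intro i j k l
    have := congrArg (smoothRing.eval U ⟨y, hy⟩) (hz i j k l)
    simpa only [map_compatSum, evH, evC', hb, map_zero] using this
  have compR : ∀ (b : Fin n → Fin n → smoothRing U) (b' : Fin n → Fin n → ℝ),
      (∀ i j, smoothRing.eval U ⟨y, hy⟩ (b i j) = b' i j) →
      (∀ i j k l, compatSum H R b i j k l = 0) → IsCompatible (riemann g y) b' := by
    intro b b' hb hz
    refine isCompatible_of_compatSum (h := (g y)⁻¹) (C := riemannLower g y) (hsymH y)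
      (fun j k l m => (raise_sum_mul_metric (hg y) (hdet y hy) (riemann g y j k l) m).symm) ?_
    intro i j k l
    have := congrArg (smoothRing.eval U ⟨y, hy⟩) (hz i j k l)
    simpa only [map_compatSum, evH, evR', hb, map_zero] using this
  refine ⟨compW _ _ (fun i j => ?_) fun i j k l => (key i j k l).1,
    compW _ _ (fun i j => ?_) fun i j k l => (key i j k l).2.1,
    compW _ _ (fun i j => ?_) fun i j k l => (key i j k l).2.2.1, fun hcl => ?_⟩
  · simp only [map_mul, evα]
  · simp only [map_add, evN, evRic]
  · simp only [map_add, map_sub, map_mul, evN, evRic, AlgHom.commutes, Fintype.card_fin,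
      Algebra.algebraMap_self, RingHom.id_apply]
  -- Closedness on all of `U` is what makes this an identity in the ring.
  · have hclA : ∀ i j, covD d K i α j - covD d K j α i = 0 := fun i j =>
      smoothRing.eval_ext fun x => by
        simpa only [map_sub, evN, map_zero] using hcl x x.2 i j
    exact ⟨compW _ _ (fun i j => evN _ i j) fun i j k l => ((key i j k l).2.2.2 hclA).1,
      compW _ _ (fun i j => evRic _ i j) fun i j k l => ((key i j k l).2.2.2 hclA).2.1,
      compR _ _ (fun i j => evRic _ i j) fun i j k l => ((key i j k l).2.2.2 hclA).2.2⟩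

end Coordinates

end ConfRec

end

/-! ### The theorem on the manifold, chart by chart with `U = e.target`. -/

theorem mainTheorem4 {n : ℕ} (hn : 5 ≤ n) {M : Type*} [TopologicalSpace M] [T2Space M]
    [ConnectedSpace M] [ChartedSpace (EuclideanSpace ℝ (Fin n)) M] [IsManifold (𝓡 n) ∞ M]
    (g : ConfRec.PseudoRiemannianMetric n M) (α : ConfRec.CovectorField n M)
    (hα : ConfRec.IsConformallyRecurrent g α) :
    ConfRec.IsWeylCompatible g (fun e y i j => α.comp e y i * α.comp e y j) ∧
    ConfRec.IsWeylCompatible g (fun e y i j =>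
      ConfRec.covDeriv1 (g.comp e) (α.comp e) y i j + ConfRec.covDeriv1 (g.comp e) (α.comp e) y j i
        + ConfRec.ricci (g.comp e) y i j) ∧
    ConfRec.IsWeylCompatible g (fun e y i m =>
      ConfRec.covDeriv1 (g.comp e) (α.comp e) y i m - ConfRec.covDeriv1 (g.comp e) (α.comp e) y m i
        + ((n : ℝ) - 4) / ((n : ℝ) - 2) * ConfRec.ricci (g.comp e) y i m) ∧
    (α.IsClosed g →
      ConfRec.IsWeylCompatible g (fun e y i j =>
        ConfRec.covDeriv1 (g.comp e) (α.comp e) y i j) ∧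
      ConfRec.IsWeylCompatible g (fun e y i j => ConfRec.ricci (g.comp e) y i j) ∧
      ConfRec.IsRiemannCompatible g (fun e y i j => ConfRec.ricci (g.comp e) y i j)) := by
  have key := fun e (he : e ∈ IsManifold.maximalAtlas (𝓡 n) ∞ M) y (hy : y ∈ e.target) =>
    ConfRec.isCompatible_of_recurrent hn e.open_target (ConfRec.contDiffOn_comp_metric g he)
      (fun y => ConfRec.comp_metric_symm g e y)
      (fun _ hy => ConfRec.isUnit_det_comp_metric g he hy)
      (ConfRec.contDiffOn_comp_covector α he) (hα.2 e he) hy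
  exact ⟨fun e he y hy => (key e he y hy).1, fun e he y hy => (key e he y hy).2.1,
    fun e he y hy => (key e he y hy).2.2.1, fun hcl =>
    ⟨fun e he y hy => ((key e he y hy).2.2.2 (hcl e he)).1,
      fun e he y hy => ((key e he y hy).2.2.2 (hcl e he)).2.1,
      fun e he y hy => ((key e he y hy).2.2.2 (hcl e he)).2.2⟩⟩
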